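/- Let $n\ge 1$ and let $H_1,\dots,H_n:\mathbb R^2\to\mathbb R$ be functions of class $C^2$ such that each $H_i$ is proper (it tends to $+\infty$ at infinity) and has a unique point of minimum and no other critical points. Put $$H(p,q)=\sum_{i=1}^n H_i(p_i,q_i),\qquad (p,q)\in\mathbb R^{2n},$$ let $E>\min H$ and let $X=\{(p,q)\in\mathbb R^{2n} : H(p,q)\le E\}$. A closed characteristic on $\partial X$ is a closed $C^1$ curve $\gamma$ in $\partial X$ with nowhere vanishing velocity such that $\dot\gamma$ always lies in the kernel of the restriction of $\omega=\sum_i dp_i\wedge dq_i$ to the tangent space of $\partial X$; its action is $\left|\int_\gamma\sum_i p_i\,dq_i\right|$. Then Viterbo's conjecture holds for $X$ (no convexity is assumed): among the actions of the closed characteristics on $\partial X$ there is a smallest one, $c_{EHZ}(X)$, and $$\operatorname{vol} X\ \ge\ \frac{c_{EHZ}(X)^n}{n!}.$$ -/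

import Mathlib

open MeasureTheory
open scoped Nat

/-- The phase space `ℝ²ⁿ`; a point is a pair `(p, q)` of momenta and coordinates. Its `volume` is
the Lebesgue measure. -/
abbrev PhaseSpace (n : ℕ) : Type := (Fin n → ℝ) × (Fin n → ℝ)

/-- The symplectic form `ω = ∑ dpᵢ ∧ dqᵢ`. -/
def symplecticForm {n : ℕ} (v w : PhaseSpace n) : ℝ :=
  ∑ i, (v.1 i * w.2 i - v.2 i * w.1 i)

/-- The vectors tangent to `∂X` at `x`. Mathlib's `tangentConeAt ℝ` allows real multiples of both
signs, so that at the points of a regular `C¹` hypersurface it is the tangent hyperplane. -/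
def boundaryTangent {n : ℕ} (X : Set (PhaseSpace n)) (x : PhaseSpace n) : Set (PhaseSpace n) :=
  tangentConeAt ℝ (frontier X) x

/-- The kernel of the restriction of `ω` to the tangent space of `∂X` at `x`. -/
def characteristicDirections {n : ℕ} (X : Set (PhaseSpace n)) (x : PhaseSpace n) :
    Set (PhaseSpace n) :=
  {v | v ∈ boundaryTangent X x ∧ ∀ w ∈ boundaryTangent X x, symplecticForm v w = 0}

/-- `γ` is a closed characteristic on `∂X` with (not necessarily minimal) period `T`: a regular
closed `C¹` curve in `∂X` whose velocity is always in the kernel of `ω` on the tangent space. -/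
structure IsClosedCharacteristic {n : ℕ} (X : Set (PhaseSpace n)) (γ : ℝ → PhaseSpace n)
    (T : ℝ) : Prop where
  contDiff : ContDiff ℝ 1 γ
  period_pos : 0 < T
  periodic : Function.Periodic γ T
  mem_frontier : ∀ t, γ t ∈ frontier X
  velocity_ne_zero : ∀ t, deriv γ t ≠ 0
  velocity_mem : ∀ t, deriv γ t ∈ characteristicDirections X (γ t)

/-- The action `∫_γ ∑ pᵢ dqᵢ` of a curve over the time interval `[0, T]`. -/
noncomputable def action {n : ℕ} (γ : ℝ → PhaseSpace n) (T : ℝ) : ℝ :=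
  ∫ t in (0 : ℝ)..T, ∑ i, (γ t).1 i * (deriv γ t).2 i

/-- The set of actions of the closed characteristics on `∂X`. The absolute value makes the action
independent of the direction in which the characteristic is traversed. -/
def closedCharacteristicActions {n : ℕ} (X : Set (PhaseSpace n)) : Set ℝ :=
  {a | ∃ (γ : ℝ → PhaseSpace n) (T : ℝ), IsClosedCharacteristic X γ T ∧ a = |action γ T|}

/-- `c_EHZ(X)`: the smallest action of a closed characteristic on `∂X`. It is meaningful when the
set of these actions has a least element. -/
noncomputable def cEHZ {n : ℕ} (X : Set (PhaseSpace n)) : ℝ :=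
  sInf (closedCharacteristicActions X)

/-- Viterbo's conjecture for the set `X ⊆ ℝ²ⁿ`: there is a smallest action `c_EHZ(X)` of a closed
characteristic on `∂X`, and `vol X ≥ c_EHZ(X)ⁿ / n!`. -/
def ViterboHolds {n : ℕ} (X : Set (PhaseSpace n)) : Prop :=
  IsLeast (closedCharacteristicActions X) (cEHZ X) ∧
    ENNReal.ofReal (cEHZ X ^ n / (n ! : ℝ)) ≤ volume X

/-- The Hamiltonian `H(p, q) = ∑ Hᵢ(pᵢ, qᵢ)` of a direct sum of one-dimensional motions. -/
def sumHamiltonian {n : ℕ} (H : Fin n → ℝ × ℝ → ℝ) (x : PhaseSpace n) : ℝ :=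
  ∑ i, H i (x.1 i, x.2 i)

/-!
Write `A i e` for the area enclosed by the level `{H i = e}` of the `i`-th planar Hamiltonian. The
Hamiltonian flow preserves every `H i`, and a closed characteristic on `{∑ H i = E}` splits energy
as `E = ∑ e i` and runs `k i ≥ 1` times around each level `{H i = e i}` (or rests at the minimum),
always in the same direction. Its action is therefore `∑ k i * A i (e i)`, hence at least the
minimum `c` of `∑ A i (e i)` over all ways to split the energy
(`IsClosedCharacteristic.sum_area_le`).

The minimum is attained. At a minimizer the derivatives of the `A i` with `e i` above the minimum
of `H i` agree by Lagrange multipliers (`period_eq_of_isMinimal`). Since the derivative of area with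
respect to energy is the period of the orbit, all nontrivial planar orbits have the same period, and
together they form a closed characteristic of action exactly `c`
(`exists_isClosedCharacteristic_of_minimal`).

For the volume, `A i ∘ H i` pushes the area of the plane forward to Lebesgue measure on `[0, ∞)`.
By minimality, the points with `∑ A i (H i) < c` lie in the sublevel set, and their volume is
that of a simplex, `c ^ n / n!` (`ofReal_le_volume_sublevel`).

The planar facts are obtained for one regular level `{h = e}` at a time, without smooth dependence
of the flow on initial conditions. The level is connected, being reached from any path in the
punctured plane along the gradient flow (`IsWell.isPreconnected_level`); each orbit is open in it,
so it is a single orbit, periodic by compactness (`IsOrbit.range_eq`,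
`IsOrbit.exists_minimal_period`). The map `tube` gives coordinates around this orbit, and averages
over thin layers converge to time integrals over the orbit
(`IsPeriodicOrbit.tendsto_integral_layer`). Applied to the constant `1` this is the formula for
the derivative of the area (`IsPeriodicOrbit.hasDerivAt_area`); combined with an integration by
parts on the plane it shows that the action of the orbit is the enclosed area
(`IsPeriodicOrbit.integral_action`).
-/

open Set Filter Topology
open scoped NNReal

/-! ### Global integral curves of bounded Lipschitz fields -/

section Flow

variable {F : Type*} [NormedAddCommGroup F] [NormedSpace ℝ F]

/-- The local solutions on `(-a, a)` agree on overlaps by uniqueness, and are glued. -/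
theorem exists_isIntegralCurve_of_lipschitzWith_of_bounded [CompleteSpace F] {V : F → F}
    {K : ℝ≥0} {M : ℝ} (hV : LipschitzWith K V) (hM : ∀ x, ‖V x‖ ≤ M) (x : F) :
    ∃ z : ℝ → F, z 0 = x ∧ ∀ t, HasDerivAt z (V (z t)) t := by
  have hM0 : 0 ≤ M := (norm_nonneg _).trans (hM x)
  have loc : ∀ a : ℝ, ∃ z : ℝ → F, z 0 = x ∧ ∀ t ∈ Ioo (-a) a, HasDerivAt z (V (z t)) t := by
    intro a
    rcases le_or_gt a 0 with ha | ha
    · exact ⟨fun _ => x, rfl, fun t ht => absurd (ht.1.trans ht.2) (by linarith)⟩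
    have h0 : (0 : ℝ) ∈ Icc (-a) a := ⟨by linarith, ha.le⟩
    have hp : IsPicardLindelof (fun _ => V) (⟨0, h0⟩ : Icc (-a) a) x ⟨M * a, by positivity⟩ 0
        ⟨M, hM0⟩ K := by
      apply IsPicardLindelof.of_time_independent (fun y _ => hM y) hV.lipschitzOnWith
      simp only [sub_zero, zero_sub, neg_neg, max_self, NNReal.coe_zero]
      exact le_rfl
    obtain ⟨z, hz0, hz⟩ := hp.exists_eq_forall_mem_Icc_hasDerivWithinAt₀
    exact ⟨z, hz0, fun t ht => (hz t (Ioo_subset_Icc_self ht)).hasDerivAt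
      (Icc_mem_nhds ht.1 ht.2)⟩
  choose z hz0 hz using loc
  have agree : ∀ a b : ℝ, a ≤ b → EqOn (z a) (z b) (Ioo (-a) a) := by
    intro a b hab t ht
    have h0 : (0 : ℝ) ∈ Ioo (-a) a := ⟨by linarith [ht.1.trans ht.2], by linarith [ht.1.trans ht.2]⟩
    exact ODE_solution_unique_of_mem_Ioo (v := fun _ => V) (s := fun _ => univ) (K := K)
      (fun _ _ => hV.lipschitzOnWith) h0 (fun s hs => ⟨hz a s hs, trivial⟩)
      (fun s hs => ⟨hz b s ⟨by linarith [hs.1], by linarith [hs.2]⟩, trivial⟩)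
      (by rw [hz0, hz0]) ht
  refine ⟨fun t => z (|t| + 1) t, by simpa using hz0 _, fun t => ?_⟩
  have hmem : t ∈ Ioo (-(|t| + 1)) (|t| + 1) := abs_lt.1 (by linarith)
  refine (hz (|t| + 1) t hmem).congr_of_eventuallyEq ?_
  filter_upwards [Ioo_mem_nhds hmem.1 hmem.2] with s hs
  have hs' : s ∈ Ioo (-(|s| + 1)) (|s| + 1) := abs_lt.1 (by linarith)
  rcases le_total (|s| + 1) (|t| + 1) with h | h
  · exact agree _ _ h hs'
  · exact (agree _ _ h hs).symm

theorem dist_le_of_integralCurves {V : F → F} {K : ℝ≥0} (hV : LipschitzWith K V) {y z : ℝ → F}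
    (hy : ∀ t, HasDerivAt y (V (y t)) t) (hz : ∀ t, HasDerivAt z (V (z t)) t) (t : ℝ) :
    dist (y t) (z t) ≤ dist (y 0) (z 0) * Real.exp (K * |t|) := by
  have key : ∀ {V : F → F} (_ : LipschitzWith K V) {y z : ℝ → F}
      (_ : ∀ t, HasDerivAt y (V (y t)) t) (_ : ∀ t, HasDerivAt z (V (z t)) t) (t : ℝ),
      0 ≤ t → dist (y t) (z t) ≤ dist (y 0) (z 0) * Real.exp (K * t) := by
    intro V hV y z hy hz t ht
    have := dist_le_of_trajectories_ODE (v := fun _ => V) (a := 0) (b := t) (fun _ => hV)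
      (fun s _ => (hy s).continuousAt.continuousWithinAt) (fun s _ => (hy s).hasDerivWithinAt)
      (fun s _ => (hz s).continuousAt.continuousWithinAt) (fun s _ => (hz s).hasDerivWithinAt)
      le_rfl t ⟨ht, le_rfl⟩
    simpa using this
  rcases le_total 0 t with ht | ht
  · rw [abs_of_nonneg ht]; exact key hV hy hz t ht
  · have rev : ∀ {y : ℝ → F}, (∀ t, HasDerivAt y (V (y t)) t) →
        ∀ t, HasDerivAt (fun s => y (-s)) ((fun x => -V x) (y (-t))) t := by
      intro y hy t
      have := (hy (-t)).scomp t (hasDerivAt_neg t)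
      simpa [Function.comp_def] using this
    have := key (V := fun x => -V x) hV.neg (rev hy) (rev hz) (-t) (by linarith)
    rw [abs_of_nonpos ht]
    simpa using this

theorem continuous_uncurry_of_integralCurves {V : F → F} {K : ℝ≥0} (hV : LipschitzWith K V)
    {ψ : F → ℝ → F} (h0 : ∀ x, ψ x 0 = x) (hψ : ∀ x t, HasDerivAt (ψ x) (V (ψ x t)) t) :
    Continuous (fun y : F × ℝ => ψ y.1 y.2) := by
  rw [continuous_iff_continuousAt]
  rintro ⟨x, t⟩
  rw [ContinuousAt, tendsto_iff_dist_tendsto_zero]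
  have h1 : Tendsto (fun y : F × ℝ => dist y.1 x * Real.exp (K * |y.2|) + dist (ψ x y.2) (ψ x t))
      (𝓝 (x, t)) (𝓝 0) := by
    have c1 : Continuous (ψ x) := continuous_iff_continuousAt.2 fun s => (hψ x s).continuousAt
    have : Continuous
        (fun y : F × ℝ => dist y.1 x * Real.exp (K * |y.2|) + dist (ψ x y.2) (ψ x t)) := by
      fun_prop
    simpa using this.tendsto (x, t)
  refine squeeze_zero (fun _ => dist_nonneg) (fun y => ?_) h1
  refine (dist_triangle _ (ψ x y.2) _).trans (add_le_add_left ?_ _)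
  simpa [h0] using dist_le_of_integralCurves hV (hψ y.1) (hψ x) y.2

end Flow

/-! ### Wells in the plane -/

/-- A potential well in the plane of momentum and position: a proper `C²` function `h` whose only
critical point is its strict minimum `m`. -/
structure IsWell (h : ℝ × ℝ → ℝ) (m : ℝ × ℝ) : Prop where
  contDiff : ContDiff ℝ 2 h
  proper : Tendsto h (cocompact (ℝ × ℝ)) atTop
  min_lt : ∀ x, x ≠ m → h m < h x
  fderiv_ne : ∀ x, x ≠ m → fderiv ℝ h x ≠ 0

/-- The Hamiltonian vector field of `h`, for the equations `p' = -∂h/∂q`, `q' = ∂h/∂p`. -/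
noncomputable def hamiltonianField (h : ℝ × ℝ → ℝ) (x : ℝ × ℝ) : ℝ × ℝ :=
  (-fderiv ℝ h x (0, 1), fderiv ℝ h x (1, 0))

/-- The gradient of `h` divided by its squared length, so that `h` grows at unit speed along it.
At a critical point its value is `0`. -/
noncomputable def unitGrowthField (h : ℝ × ℝ → ℝ) (x : ℝ × ℝ) : ℝ × ℝ :=
  (fderiv ℝ h x (1, 0) ^ 2 + fderiv ℝ h x (0, 1) ^ 2)⁻¹ •
    (fderiv ℝ h x (1, 0), fderiv ℝ h x (0, 1))

theorem fderiv_apply_eq (h : ℝ × ℝ → ℝ) (x v : ℝ × ℝ) :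
    fderiv ℝ h x v = v.1 * fderiv ℝ h x (1, 0) + v.2 * fderiv ℝ h x (0, 1) := by
  have : v = v.1 • ((1, 0) : ℝ × ℝ) + v.2 • ((0, 1) : ℝ × ℝ) := by ext <;> simp
  conv_lhs => rw [this]
  rw [map_add, map_smul, map_smul, smul_eq_mul, smul_eq_mul]

theorem fderiv_hamiltonianField (h : ℝ × ℝ → ℝ) (x : ℝ × ℝ) :
    fderiv ℝ h x (hamiltonianField h x) = 0 := by
  rw [fderiv_apply_eq]; simp [hamiltonianField]; ring

namespace IsWell

variable {h : ℝ × ℝ → ℝ} {m : ℝ × ℝ}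

theorem continuous (w : IsWell h m) : Continuous h := w.contDiff.continuous

theorem hasFDerivAt (w : IsWell h m) (x : ℝ × ℝ) : HasFDerivAt h (fderiv ℝ h x) x :=
  (w.contDiff.differentiable (by norm_num) x).hasFDerivAt

theorem contDiff_fderiv (w : IsWell h m) : ContDiff ℝ 1 (fderiv ℝ h) :=
  w.contDiff.fderiv_right (by norm_num)

theorem contDiff_fderiv_apply (w : IsWell h m) (v : ℝ × ℝ) :
    ContDiff ℝ 1 (fun x => fderiv ℝ h x v) :=
  w.contDiff_fderiv.clm_apply contDiff_const

theorem contDiff_hamiltonianField (w : IsWell h m) : ContDiff ℝ 1 (hamiltonianField h) :=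
  (w.contDiff_fderiv_apply _).neg.prodMk (w.contDiff_fderiv_apply _)

theorem gradient_sq_pos (w : IsWell h m) {x : ℝ × ℝ} (hx : x ≠ m) :
    0 < fderiv ℝ h x (1, 0) ^ 2 + fderiv ℝ h x (0, 1) ^ 2 := by
  by_contra hc
  have s1 := sq_nonneg (fderiv ℝ h x (1, 0))
  have s2 := sq_nonneg (fderiv ℝ h x (0, 1))
  have h1 : fderiv ℝ h x (1, 0) = 0 := by
    rw [← sq_eq_zero_iff]; linarith
  have h2 : fderiv ℝ h x (0, 1) = 0 := by
    rw [← sq_eq_zero_iff]; linarith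
  refine w.fderiv_ne x hx (ContinuousLinearMap.ext fun v => ?_)
  rw [fderiv_apply_eq, h1, h2]; simp

theorem hamiltonianField_ne_zero (w : IsWell h m) {x : ℝ × ℝ} (hx : x ≠ m) :
    hamiltonianField h x ≠ 0 := by
  intro h0
  have := w.gradient_sq_pos hx
  simp only [hamiltonianField, Prod.mk_eq_zero, neg_eq_zero] at h0
  rw [h0.1, h0.2] at this
  norm_num at this

theorem fderiv_min (w : IsWell h m) : fderiv ℝ h m = 0 := by
  apply IsLocalMin.fderiv_eq_zero
  filter_upwards with x
  rcases eq_or_ne x m with rfl | hx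
  exacts [le_rfl, (w.min_lt x hx).le]

theorem hamiltonianField_min (w : IsWell h m) : hamiltonianField h m = 0 := by
  simp [hamiltonianField, w.fderiv_min]

theorem fderiv_unitGrowthField (w : IsWell h m) {x : ℝ × ℝ} (hx : x ≠ m) :
    fderiv ℝ h x (unitGrowthField h x) = 1 := by
  have := w.gradient_sq_pos hx
  have key := fderiv_apply_eq h x (fderiv ℝ h x (1, 0), fderiv ℝ h x (0, 1))
  rw [unitGrowthField, map_smul, key, smul_eq_mul, ← sq, ← sq]
  exact inv_mul_cancel₀ this.ne'

theorem contDiffAt_unitGrowthField (w : IsWell h m) {x : ℝ × ℝ} (hx : x ≠ m) :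
    ContDiffAt ℝ 1 (unitGrowthField h) x := by
  have h1 := (w.contDiff_fderiv_apply (1, 0)).contDiffAt (x := x)
  have h2 := (w.contDiff_fderiv_apply (0, 1)).contDiffAt (x := x)
  exact ((h1.pow 2).add (h2.pow 2)).inv (w.gradient_sq_pos hx).ne' |>.smul (h1.prodMk h2)

theorem min_le (w : IsWell h m) (x : ℝ × ℝ) : h m ≤ h x := by
  rcases eq_or_ne x m with rfl | hx
  exacts [le_rfl, (w.min_lt x hx).le]

theorem ne_of_lt {x : ℝ × ℝ} (hx : h m < h x) : x ≠ m := by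
  rintro rfl; exact lt_irrefl _ hx

theorem isCompact_sublevel (w : IsWell h m) (b : ℝ) : IsCompact {x | h x ≤ b} := by
  have h1 : {x | h x ≤ b}ᶜ ∈ cocompact (ℝ × ℝ) := by
    filter_upwards [w.proper (Ioi_mem_atTop b)] with x hx
    simpa using hx
  obtain ⟨t, ht, hts⟩ := mem_cocompact.1 h1
  exact ht.of_isClosed_subset (isClosed_le w.continuous continuous_const)
    (compl_subset_compl.1 hts)

theorem isCompact_level (w : IsWell h m) (e : ℝ) : IsCompact {x | h x = e} :=
  (w.isCompact_sublevel e).of_isClosed_subset (isClosed_eq w.continuous continuous_const)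
    fun _ hx => le_of_eq hx

/-- A `C¹` field on the complement of the minimum can be multiplied by a function of `h`, equal to
`1` for energies in `[a, b]`, so that it becomes bounded and globally Lipschitz. -/
theorem exists_cutoff (w : IsWell h m) {Z : ℝ × ℝ → ℝ × ℝ} (hZ : ∀ x, x ≠ m → ContDiffAt ℝ 1 Z x)
    {a b : ℝ} (ha : h m < a) (hab : a ≤ b) :
    ∃ (ρ : ℝ → ℝ) (K L : ℝ≥0) (M : ℝ), (∀ s ∈ Icc a b, ρ s = 1) ∧ ρ (h m) = 0 ∧
      LipschitzWith L ρ ∧ LipschitzWith K (fun x => ρ (h x) • Z x) ∧ ∀ x, ‖ρ (h x) • Z x‖ ≤ M := by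
  set d := (a - h m) / 3 with hd
  have hd0 : 0 < d := by simp only [hd]; linarith
  let ρ : ContDiffBump ((a + b) / 2 : ℝ) :=
    ⟨(b - a) / 2 + d, (b - a) / 2 + 2 * d, by linarith, by linarith⟩
  have hρ : ContDiff ℝ 1 ρ := ρ.contDiff
  have hlow : ∀ s, s ≤ a - 2 * d → ρ s = 0 := fun s hs => by
    apply ρ.zero_of_le_dist
    rw [Real.dist_eq, abs_of_nonpos (by linarith)]
    change (b - a) / 2 + 2 * d ≤ _
    linarith
  have hhigh : ∀ s, b + 2 * d ≤ s → ρ s = 0 := fun s hs => by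
    apply ρ.zero_of_le_dist
    rw [Real.dist_eq, abs_of_nonneg (by linarith)]
    change (b - a) / 2 + 2 * d ≤ _
    linarith
  have hV : ContDiff ℝ 1 (fun x => ρ (h x) • Z x) := by
    rw [contDiff_iff_contDiffAt]
    intro x
    rcases eq_or_ne x m with rfl | hx
    · have : (fun y => ρ (h y) • Z y) =ᶠ[𝓝 x] fun _ => 0 := by
        filter_upwards [w.continuous.continuousAt.eventually_lt continuousAt_const
          (show h x < a - 2 * d by linarith)] with y hy
        rw [hlow _ hy.le, zero_smul]
      exact contDiffAt_const.congr_of_eventuallyEq this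
    · exact (hρ.comp (w.contDiff.of_le (by norm_num))).contDiffAt.smul (hZ x hx)
  have hc : HasCompactSupport (fun x => ρ (h x) • Z x) := by
    refine HasCompactSupport.intro (w.isCompact_sublevel (b + 2 * d)) fun x hx => ?_
    rw [hhigh _ (le_of_lt (by simpa using hx)), zero_smul]
  obtain ⟨K, hK⟩ := hV.lipschitzWith_of_hasCompactSupport hc one_ne_zero
  obtain ⟨L, hL⟩ := hρ.lipschitzWith_of_hasCompactSupport ρ.hasCompactSupport one_ne_zero
  obtain ⟨M, hM⟩ := hc.exists_bound_of_continuous hV.continuous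
  refine ⟨ρ, K, L, M, fun s hs => ?_, hlow _ (by linarith), hL, hK, hM⟩
  apply ρ.one_of_mem_closedBall
  rw [Real.closedBall_eq_Icc]
  change s ∈ Icc ((a + b) / 2 - ((b - a) / 2 + d)) ((a + b) / 2 + ((b - a) / 2 + d))
  constructor <;> linarith [hs.1, hs.2]

theorem hasDerivAt_comp (w : IsWell h m) {z : ℝ → ℝ × ℝ} {v : ℝ × ℝ} {t : ℝ}
    (hz : HasDerivAt z v t) : HasDerivAt (fun s => h (z s)) (fderiv ℝ h (z t) v) t :=
  (w.hasFDerivAt (z t)).comp_hasDerivAt t hz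

theorem exists_orbit (w : IsWell h m) {x : ℝ × ℝ} (hx : h m < h x) :
    ∃ z : ℝ → ℝ × ℝ, z 0 = x ∧ (∀ t, HasDerivAt z (hamiltonianField h (z t)) t) ∧
      ∀ t, h (z t) = h x := by
  obtain ⟨ρ, K, L, M, hρ, -, -, hK, hM⟩ := w.exists_cutoff
    (fun y _ => w.contDiff_hamiltonianField.contDiffAt) hx le_rfl
  obtain ⟨z, hz0, hz⟩ := exists_isIntegralCurve_of_lipschitzWith_of_bounded hK hM x
  have hconst : ∀ t, h (z t) = h x := by
    have hd : ∀ t, HasDerivAt (fun s => h (z s)) 0 t := fun t => by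
      simpa [map_smul, fderiv_hamiltonianField] using w.hasDerivAt_comp (hz t)
    intro t
    have := is_const_of_deriv_eq_zero (fun t => (hd t).differentiableAt)
      (fun t => (hd t).deriv) t 0
    simpa [hz0] using this
  refine ⟨z, hz0, fun t => ?_, hconst⟩
  have := hz t
  rwa [hconst, hρ _ ⟨le_rfl, le_rfl⟩, one_smul] at this

/-- Two curves in a regular level which follow the Hamiltonian field at the same variable speed
agree as soon as they meet. -/
theorem eq_of_hasDerivAt_smul (w : IsWell h m) {e : ℝ} (he : h m < e) {lam : ℝ → ℝ}
    (hlam : Continuous lam) {y z : ℝ → ℝ × ℝ}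
    (hy : ∀ t, HasDerivAt y (lam t • hamiltonianField h (y t)) t) (hye : ∀ t, h (y t) = e)
    (hz : ∀ t, HasDerivAt z (lam t • hamiltonianField h (z t)) t) (hze : ∀ t, h (z t) = e)
    {t₀ : ℝ} (h0 : y t₀ = z t₀) : y = z := by
  obtain ⟨ρ, K, L, M, hρ, -, -, hK, -⟩ := w.exists_cutoff
    (fun y _ => w.contDiff_hamiltonianField.contDiffAt) he le_rfl
  have hlip : LipschitzOnWith K (hamiltonianField h) {x | h x = e} := by
    intro x hx x' hx'
    have := hK x x'
    beta_reduce at this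
    rw [show h x = e from hx, show h x' = e from hx', hρ e ⟨le_rfl, le_rfl⟩] at this
    simpa only [one_smul] using this
  ext1 t
  set R := |t| + |t₀| + 1 with hR
  have ht : t ∈ Ioo (-R) R := abs_lt.1 (by linarith [abs_nonneg t₀])
  have ht₀ : t₀ ∈ Ioo (-R) R := abs_lt.1 (by linarith [abs_nonneg t])
  obtain ⟨C, hC⟩ := isCompact_Icc.exists_bound_of_continuousOn (s := Icc (-R) R)
    hlam.continuousOn
  have hC0 : 0 ≤ C := (norm_nonneg _).trans (hC t (Ioo_subset_Icc_self ht))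
  refine ODE_solution_unique_of_mem_Ioo (v := fun t x => lam t • hamiltonianField h x)
    (s := fun _ => {x | h x = e}) (K := C.toNNReal * K) (fun s hs => ?_) ht₀
    (fun s _ => ⟨hy s, hye s⟩) (fun s _ => ⟨hz s, hze s⟩) h0 ht
  refine LipschitzOnWith.of_dist_le_mul fun x hx x' hx' => ?_
  have := hlip.dist_le_mul x hx x' hx'
  rw [dist_smul₀]
  calc ‖lam s‖ * dist (hamiltonianField h x) (hamiltonianField h x')
      ≤ C * (K * dist x x') := by
        gcongr
        exact hC s (Ioo_subset_Icc_self hs)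
    _ = _ := by rw [NNReal.coe_mul, mul_assoc, Real.coe_toNNReal C hC0]

theorem eq_of_orbits_meet (w : IsWell h m) {e : ℝ} (he : h m < e) {y z : ℝ → ℝ × ℝ}
    (hy : ∀ t, HasDerivAt y (hamiltonianField h (y t)) t) (hye : ∀ t, h (y t) = e)
    (hz : ∀ t, HasDerivAt z (hamiltonianField h (z t)) t) (hze : ∀ t, h (z t) = e)
    {s t : ℝ} (hst : y s = z t) (r : ℝ) : y (s + r) = z (t + r) := by
  have := w.eq_of_hasDerivAt_smul he (lam := fun _ => 1) continuous_const
    (y := fun r => y (s + r)) (z := fun r => z (t + r))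
    (fun r => by simpa using (hy (s + r)).comp_const_add s r) (fun r => hye _)
    (fun r => by simpa using (hz (t + r)).comp_const_add t r) (fun r => hze _)
    (t₀ := 0) (by simpa using hst)
  exact congrFun this r

/-- Regular levels are connected: a path in the punctured plane is pushed to the level along the
flow of a cutoff of `unitGrowthField`. -/
theorem isPreconnected_level (w : IsWell h m) {e : ℝ} (he : h m < e) :
    IsPreconnected {x | h x = e} := by
  refine isPreconnected_of_forall_pair fun x hx y hy => ?_
  have hpc : IsPathConnected ({m}ᶜ : Set (ℝ × ℝ)) :=
    isPathConnected_compl_singleton_of_one_lt_rank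
      (by rw [← Module.finrank_eq_rank]; simp) m
  have hxm : x ∈ ({m}ᶜ : Set (ℝ × ℝ)) := ne_of_lt (h := h) (by rw [hx]; exact he)
  have hym : y ∈ ({m}ᶜ : Set (ℝ × ℝ)) := ne_of_lt (h := h) (by rw [hy]; exact he)
  obtain ⟨γ, hγ⟩ := hpc.joinedIn x hxm y hym
  have hcont : Continuous (fun t => h (γ t)) := w.continuous.comp γ.continuous
  obtain ⟨t₁, -, ht₁⟩ := isCompact_univ.exists_isMinOn ⟨0, trivial⟩ hcont.continuousOn
  obtain ⟨t₂, -, ht₂⟩ := isCompact_univ.exists_isMaxOn ⟨0, trivial⟩ hcont.continuousOn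
  have hlow : ∀ t, h (γ t₁) ≤ h (γ t) := fun t => ht₁ (mem_univ t)
  have hhigh : ∀ t, h (γ t) ≤ h (γ t₂) := fun t => ht₂ (mem_univ t)
  have he1 : h (γ t₁) ≤ e := by have := hlow 0; rwa [γ.source, hx] at this
  have he2 : e ≤ h (γ t₂) := by have := hhigh 0; rwa [γ.source, hx] at this
  obtain ⟨ρ, K, L, M, hρ, hρm, hL, hK, hM⟩ := w.exists_cutoff
    (fun y hy => w.contDiffAt_unitGrowthField hy) (w.min_lt _ (hγ t₁)) (he1.trans he2)
  choose ψ hψ0 hψ using exists_isIntegralCurve_of_lipschitzWith_of_bounded hK hM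
  have hψc := continuous_uncurry_of_integralCurves hK hψ0 hψ
  -- The energy along the flow solves a scalar equation, of which `s ↦ h u + s` is a solution.
  have hflow : ∀ u, h (γ t₁) ≤ h u → h u ≤ h (γ t₂) → h (ψ u (e - h u)) = e := by
    intro u hu1 hu2
    have hd : ∀ s, HasDerivAt (fun s => h (ψ u s)) (ρ (h (ψ u s))) s := by
      -- At the minimum `unitGrowthField` vanishes instead of having unit growth, but so does `ρ`.
      intro s
      have := w.hasDerivAt_comp (hψ u s)
      rw [map_smul, smul_eq_mul] at this
      rcases eq_or_ne (ψ u s) m with hm | hm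
      · rwa [hm, hρm, zero_mul, ← hρm, ← hm] at this
      · rwa [w.fderiv_unitGrowthField hm, mul_one] at this
    -- The sign `σ` treats the flow forward and backward in time at once.
    have key : ∀ σ : ℝ, σ * σ = 1 → 0 ≤ σ * (e - h u) → h (ψ u (e - h u)) = e := by
      intro σ hσ hS
      have hf : ∀ s, HasDerivAt (fun s => h (ψ u (σ * s))) (σ * ρ (h (ψ u (σ * s)))) s := by
        intro s
        simpa [Function.comp_def] using
          (hd (σ * s)).scomp s ((hasDerivAt_id s).const_mul σ)
      have hg : ∀ s, HasDerivAt (fun s => h u + σ * s) σ s := fun s => by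
        simpa using ((hasDerivAt_id s).const_mul σ).const_add (h u)
      have hLσ : LipschitzWith (‖σ‖₊ * L) (fun x => σ * ρ x) := by
        refine LipschitzWith.of_dist_le_mul fun x y => ?_
        rw [Real.dist_eq, ← mul_sub, abs_mul, NNReal.coe_mul, mul_assoc]
        exact mul_le_mul_of_nonneg_left (hL.dist_le_mul x y) (abs_nonneg _)
      have := ODE_solution_unique (v := fun _ x => σ * ρ x) (a := 0) (b := σ * (e - h u))
        (fun _ => hLσ) (fun s _ => (hf s).continuousAt.continuousWithinAt)
        (fun s _ => (hf s).hasDerivWithinAt) (fun s _ => (hg s).continuousAt.continuousWithinAt)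
        (fun s hs => ?_) (by simp [hψ0]) ⟨hS, le_rfl⟩
      · simpa [← mul_assoc, hσ] using this
      · have h1 : ρ (h u + σ * s) = 1 := by
          apply hρ
          have hs2 := hs.2.le
          rcases mul_self_eq_one_iff.1 hσ with rfl | rfl <;> constructor <;> linarith [hs.1]
        have := (hg s).hasDerivWithinAt (s := Ici s)
        rwa [h1, mul_one]
    rcases le_total (h u) e with hle | hle
    · exact key 1 (by norm_num) (by linarith)
    · exact key (-1) (by norm_num) (by linarith)
  have hr : Continuous (fun t => ψ (γ t) (e - h (γ t))) :=
    hψc.comp (γ.continuous.prodMk (continuous_const.sub hcont))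
  refine ⟨range fun t => ψ (γ t) (e - h (γ t)), ?_, ⟨0, ?_⟩, ⟨1, ?_⟩,
    isPreconnected_range hr⟩
  · rintro _ ⟨t, rfl⟩
    exact hflow _ (hlow t) (hhigh t)
  · simp [show h x = e from hx, hψ0]
  · simp [show h y = e from hy, hψ0]

end IsWell

/-! ### Trajectories on a regular level -/

theorem ContinuousLinearMap.det_prod_real (L : ℝ × ℝ →L[ℝ] ℝ × ℝ) :
    L.det = (L (1, 0)).1 * (L (0, 1)).2 - (L (0, 1)).1 * (L (1, 0)).2 := by
  rw [ContinuousLinearMap.det, ← LinearMap.det_toMatrix (Module.Basis.finTwoProd ℝ),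
    Matrix.det_fin_two]
  simp [LinearMap.toMatrix_apply]

/-- `z` is a trajectory of the Hamiltonian field of `h` on the level `{h = e}`. -/
structure IsOrbit (h : ℝ × ℝ → ℝ) (e : ℝ) (z : ℝ → ℝ × ℝ) : Prop where
  hasDerivAt : ∀ t, HasDerivAt z (hamiltonianField h (z t)) t
  energy : ∀ t, h (z t) = e

/-- Coordinates around a trajectory `z`: the point `(s, t)` is sent to the point of parameter `s`
on the line through `z t` in the direction of `unitGrowthField`. -/
noncomputable def tube (h : ℝ × ℝ → ℝ) (z : ℝ → ℝ × ℝ) (y : ℝ × ℝ) : ℝ × ℝ :=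
  z y.2 + y.1 • unitGrowthField h (z y.2)

theorem tube_zero (h : ℝ × ℝ → ℝ) (z : ℝ → ℝ × ℝ) (t : ℝ) : tube h z (0, t) = z t := by
  simp [tube]

namespace IsOrbit

variable {h : ℝ × ℝ → ℝ} {m : ℝ × ℝ} {e : ℝ} {z : ℝ → ℝ × ℝ}

theorem continuous (o : IsOrbit h e z) : Continuous z :=
  continuous_iff_continuousAt.2 fun t => (o.hasDerivAt t).continuousAt

theorem contDiff (o : IsOrbit h e z) (w : IsWell h m) : ContDiff ℝ 1 z := by
  rw [contDiff_one_iff_deriv]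
  refine ⟨fun t => (o.hasDerivAt t).differentiableAt, ?_⟩
  rw [show deriv z = fun t => hamiltonianField h (z t) from funext fun t => (o.hasDerivAt t).deriv]
  exact w.contDiff_hamiltonianField.continuous.comp o.continuous

theorem ne_min (o : IsOrbit h e z) (he : h m < e) (t : ℝ) : z t ≠ m :=
  IsWell.ne_of_lt (h := h) (by rwa [o.energy])

theorem contDiff_tube (o : IsOrbit h e z) (w : IsWell h m) (he : h m < e) :
    ContDiff ℝ 1 (tube h z) := by
  have h1 : ContDiff ℝ 1 (fun t => unitGrowthField h (z t)) :=
    contDiff_iff_contDiffAt.2 fun t =>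
      (w.contDiffAt_unitGrowthField (o.ne_min he t)).comp t (o.contDiff w).contDiffAt
  exact ((o.contDiff w).comp contDiff_snd).add (contDiff_fst.smul (h1.comp contDiff_snd))

theorem fderiv_tube_fst (o : IsOrbit h e z) (w : IsWell h m) (he : h m < e) (t : ℝ) :
    fderiv ℝ (tube h z) (0, t) (1, 0) = unitGrowthField h (z t) := by
  have h1 := ((o.contDiff_tube w he).differentiable one_ne_zero (0, t)).hasFDerivAt
  have h2 : HasDerivAt (fun s : ℝ => (s, t)) ((1 : ℝ), (0 : ℝ)) 0 :=
    (hasDerivAt_id (0 : ℝ)).prodMk (hasDerivAt_const 0 t)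
  have h3 : HasDerivAt (fun s : ℝ => tube h z (s, t)) (unitGrowthField h (z t)) 0 := by
    simpa [tube] using
      ((hasDerivAt_id (0 : ℝ)).smul_const (unitGrowthField h (z t))).const_add (z t)
  have h4 : HasDerivAt (fun s : ℝ => tube h z (s, t)) (fderiv ℝ (tube h z) (0, t) (1, 0)) 0 :=
    h1.comp_hasDerivAt_of_eq (0 : ℝ) h2 rfl
  exact h4.unique h3

theorem fderiv_tube_snd (o : IsOrbit h e z) (w : IsWell h m) (he : h m < e) (t : ℝ) :
    fderiv ℝ (tube h z) (0, t) (0, 1) = hamiltonianField h (z t) := by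
  have h1 := ((o.contDiff_tube w he).differentiable one_ne_zero (0, t)).hasFDerivAt
  have h2 : HasDerivAt (fun s : ℝ => ((0 : ℝ), s)) ((0 : ℝ), (1 : ℝ)) t :=
    (hasDerivAt_const t 0).prodMk (hasDerivAt_id t)
  have h3 : HasDerivAt (fun s : ℝ => tube h z (0, s)) (hamiltonianField h (z t)) t := by
    simpa only [tube_zero] using o.hasDerivAt t
  exact (h3.unique (h1.comp_hasDerivAt t h2)).symm

theorem det_fderiv_tube (o : IsOrbit h e z) (w : IsWell h m) (he : h m < e) (t : ℝ) :
    (fderiv ℝ (tube h z) (0, t)).det = 1 := by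
  have := (w.gradient_sq_pos (o.ne_min he t)).ne'
  rw [ContinuousLinearMap.det_prod_real, o.fderiv_tube_fst w he, o.fderiv_tube_snd w he]
  simp only [unitGrowthField, hamiltonianField, Prod.smul_mk, smul_eq_mul]
  refine Eq.trans ?_ (mul_inv_cancel₀ this)
  ring

theorem exists_hasStrictFDerivAt_equiv (o : IsOrbit h e z) (w : IsWell h m) (he : h m < e)
    (t : ℝ) :
    ∃ L : (ℝ × ℝ) ≃L[ℝ] ℝ × ℝ, HasStrictFDerivAt (tube h z) (L : ℝ × ℝ →L[ℝ] ℝ × ℝ) (0, t) := by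
  have hdet : (fderiv ℝ (tube h z) (0, t)).det ≠ 0 := by
    rw [o.det_fderiv_tube w he]; exact one_ne_zero
  refine ⟨(fderiv ℝ (tube h z) (0, t)).toContinuousLinearEquivOfDetNeZero hdet, ?_⟩
  rw [ContinuousLinearMap.coe_toContinuousLinearEquivOfDetNeZero]
  exact (o.contDiff_tube w he).contDiffAt.hasStrictFDerivAt one_ne_zero

theorem map_nhds_tube (o : IsOrbit h e z) (w : IsWell h m) (he : h m < e) (t : ℝ) :
    map (tube h z) (𝓝 (0, t)) = 𝓝 (z t) := by
  obtain ⟨L, hL⟩ := o.exists_hasStrictFDerivAt_equiv w he t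
  rw [hL.map_nhds_eq_of_equiv, tube_zero]

theorem exists_injOn_tube (o : IsOrbit h e z) (w : IsWell h m) (he : h m < e) (t : ℝ) :
    ∃ u ∈ 𝓝 ((0 : ℝ), t), InjOn (tube h z) u := by
  obtain ⟨L, hL⟩ := o.exists_hasStrictFDerivAt_equiv w he t
  refine ⟨_, hL.eventually_left_inverse, fun x hx y hy hxy => ?_⟩
  rw [← show hL.localInverse _ _ _ (tube h z x) = x from hx, hxy]
  exact hy

theorem hasStrictFDerivAt_energy_tube (o : IsOrbit h e z) (w : IsWell h m) (he : h m < e)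
    (t : ℝ) :
    HasStrictFDerivAt (fun y => h (tube h z y)) (ContinuousLinearMap.fst ℝ ℝ ℝ) (0, t) := by
  have h1 := (o.contDiff_tube w he).contDiffAt (x := (0, t)) |>.hasStrictFDerivAt one_ne_zero
  have h2 := w.contDiff.contDiffAt (x := tube h z (0, t)) |>.hasStrictFDerivAt two_ne_zero
  refine (h2.comp (0, t) h1).congr_fderiv ?_
  ext
  · simp [o.fderiv_tube_fst w he, tube_zero, w.fderiv_unitGrowthField (o.ne_min he t)]
  · simp [o.fderiv_tube_snd w he, tube_zero, fderiv_hamiltonianField]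

/-- To first order, the transversal coordinate of the tube is the gain of energy. -/
theorem eventually_abs_energy_tube_sub_le (o : IsOrbit h e z) (w : IsWell h m) (he : h m < e)
    (t : ℝ) : ∀ᶠ y in 𝓝 ((0 : ℝ), t), |h (tube h z y) - e - y.1| ≤ 1 / 2 * |y.1| := by
  have h1 := (o.hasStrictFDerivAt_energy_tube w he t).isLittleO.def (c := 1 / 2) (by norm_num)
  have h2 : Tendsto (fun y : ℝ × ℝ => (y, ((0 : ℝ), y.2))) (𝓝 (0, t)) (𝓝 ((0, t), (0, t))) := by
    have : Continuous (fun y : ℝ × ℝ => (y, ((0 : ℝ), y.2))) := by fun_prop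
    exact this.tendsto (0, t)
  filter_upwards [h2.eventually h1] with y hy
  simpa [tube_zero, o.energy, Prod.norm_def] using hy

/-- Near a point of a trajectory, the level consists of the trajectory alone. -/
theorem eventually_mem_image (o : IsOrbit h e z) (w : IsWell h m) (he : h m < e) (t : ℝ)
    {u : Set ℝ} (hu : u ∈ 𝓝 t) : ∀ᶠ x in 𝓝 (z t), h x = e → x ∈ z '' u := by
  rw [← o.map_nhds_tube w he, eventually_map]
  have h1 : ∀ᶠ y : ℝ × ℝ in 𝓝 (0, t), y.2 ∈ u := continuous_snd.continuousAt.eventually hu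
  filter_upwards [o.eventually_abs_energy_tube_sub_le w he t, h1] with y hy hyu hye
  rw [hye, sub_self, zero_sub, abs_neg] at hy
  have : y.1 = 0 := abs_eq_zero.1 (by linarith [abs_nonneg y.1])
  exact ⟨y.2, hyu, by rw [← tube_zero h z, ← this]⟩

/-- A trajectory fills its level, because the level is connected. -/
theorem range_eq (o : IsOrbit h e z) (w : IsWell h m) (he : h m < e) :
    range z = {x | h x = e} := by
  have hsub : ∀ {y : ℝ → ℝ × ℝ}, IsOrbit h e y → range y ⊆ {x | h x = e} := by
    rintro y oy _ ⟨t, rfl⟩; exact oy.energy t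
  refine (hsub o).antisymm ?_
  -- Every trajectory is open in the level, hence so is the complement of `range z`.
  have hopen : ∀ {y : ℝ → ℝ × ℝ}, IsOrbit h e y → ∀ x ∈ range y,
      ∀ᶠ x' in 𝓝 x, h x' = e → x' ∈ range y := by
    rintro y oy _ ⟨t, rfl⟩
    filter_upwards [oy.eventually_mem_image w he t univ_mem] with x hx hxe
    exact image_subset_range _ _ (hx hxe)
  have hrel : ∀ x, h x = e → x ∉ range z → ∀ᶠ x' in 𝓝 x, h x' = e → x' ∉ range z := by
    intro x hx hxz
    obtain ⟨y, hy0, hy, hye⟩ := w.exists_orbit (x := x) (by rwa [hx])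
    have oy : IsOrbit h e y := ⟨hy, fun t => (hye t).trans hx⟩
    filter_upwards [hopen oy x ⟨0, hy0⟩] with x' hx' hx'e hx'z
    obtain ⟨s, hs⟩ := hx' hx'e
    obtain ⟨r, hr⟩ := hx'z
    have := w.eq_of_orbits_meet he oy.hasDerivAt oy.energy o.hasDerivAt o.energy
      (hs.trans hr.symm) (-s)
    exact hxz ⟨r + -s, by rw [← this, add_neg_cancel, hy0]⟩
  intro x hx
  by_contra hxz
  obtain ⟨y, hye, hy1, hy2⟩ := w.isPreconnected_level he
    (interior {x' | h x' = e → x' ∈ range z}) (interior {x' | h x' = e → x' ∉ range z})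
    isOpen_interior isOpen_interior
    (fun x' hx' => by
      by_cases hx'z : x' ∈ range z
      · exact Or.inl (mem_interior_iff_mem_nhds.2 (hopen o x' hx'z))
      · exact Or.inr (mem_interior_iff_mem_nhds.2 (hrel x' hx' hx'z)))
    ⟨z 0, o.energy 0, mem_interior_iff_mem_nhds.2 (hopen o _ ⟨0, rfl⟩)⟩
    ⟨x, hx, mem_interior_iff_mem_nhds.2 (hrel x hx hxz)⟩
  exact interior_subset hy2 hye (interior_subset hy1 hye)

theorem periodic_of_eq (o : IsOrbit h e z) (w : IsWell h m) (he : h m < e) {s t : ℝ}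
    (hst : z s = z t) : Function.Periodic z (s - t) := fun r => by
  have := w.eq_of_orbits_meet he o.hasDerivAt o.energy o.hasDerivAt o.energy hst (r - t)
  rw [show r + (s - t) = s + (r - t) by ring, this]
  congr 1; ring

/-- By compactness of the level, a bounded piece of the trajectory already covers it, so that the
trajectory returns. -/
theorem exists_periodic (o : IsOrbit h e z) (w : IsWell h m) (he : h m < e) :
    ∃ T, 0 < T ∧ Function.Periodic z T := by
  have hcov : {x | h x = e} ⊆ ⋃ n : ℕ, interior {x | h x = e → x ∈ z '' Ioo (-(n : ℝ)) n} := by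
    intro x hx
    obtain ⟨t, rfl⟩ : x ∈ range z := by rw [o.range_eq w he]; exact hx
    obtain ⟨n, hn⟩ := exists_nat_gt |t|
    refine mem_iUnion.2 ⟨n, mem_interior_iff_mem_nhds.2 ?_⟩
    exact o.eventually_mem_image w he t (Ioo_mem_nhds (abs_lt.1 hn).1 (abs_lt.1 hn).2)
  have hmono : Monotone fun n : ℕ => interior {x | h x = e → x ∈ z '' Ioo (-(n : ℝ)) n} := by
    intro a b hab
    have : (a : ℝ) ≤ b := by exact_mod_cast hab
    exact interior_mono fun x hx hxe =>
      image_mono (Ioo_subset_Ioo (by linarith) this) (hx hxe)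
  obtain ⟨n, hn⟩ := (w.isCompact_level e).elim_directed_cover _ (fun _ => isOpen_interior) hcov
    hmono.directed_le
  obtain ⟨t, ht, htz⟩ := interior_subset (hn (o.energy n)) (o.energy n)
  exact ⟨n - t, by linarith [ht.2], o.periodic_of_eq w he htz.symm⟩

/-- A trajectory on a regular level has a smallest positive period `T`: its periods form a closed
subgroup of `ℝ` which is not everything. -/
theorem exists_minimal_period (o : IsOrbit h e z) (w : IsWell h m) (he : h m < e) :
    ∃ T, 0 < T ∧ Function.Periodic z T ∧ ∀ s t, z s = z t → ∃ k : ℤ, s - t = k * T := by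
  let P : AddSubgroup ℝ :=
    { carrier := {T | Function.Periodic z T}
      add_mem' := fun ha hb => ha.add_period hb
      zero_mem' := fun x => by simp
      neg_mem' := fun ha => ha.neg }
  have hclosed : IsClosed (P : Set ℝ) := by
    have : (P : Set ℝ) = ⋂ x, {T | z (x + T) = z x} := by
      ext T; simp [P, Function.Periodic]
    rw [this]
    exact isClosed_iInter fun x =>
      isClosed_eq (o.continuous.comp (continuous_const.add continuous_id)) continuous_const
  rcases P.dense_or_cyclic with hd | ⟨a, ha⟩
  · exfalso
    have huniv : (P : Set ℝ) = univ := by rw [← hclosed.closure_eq]; exact hd.closure_eq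
    have hconst : z = fun _ => z 0 := funext fun t => by
      have : t ∈ (P : Set ℝ) := huniv ▸ trivial
      simpa using this 0
    have h1 := o.hasDerivAt 0
    rw [hconst] at h1
    exact w.hamiltonianField_ne_zero (o.ne_min he 0) ((hasDerivAt_const _ _).unique h1).symm
  · have hmem : ∀ T, Function.Periodic z T → ∃ k : ℤ, T = k * a := fun T hT => by
      have : T ∈ P := hT
      rw [ha, AddSubgroup.mem_closure_singleton] at this
      obtain ⟨k, hk⟩ := this
      exact ⟨k, by rw [← hk, zsmul_eq_mul]⟩
    have haP : Function.Periodic z a := by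
      have : a ∈ P := by rw [ha]; exact AddSubgroup.mem_closure_singleton_self a
      exact this
    obtain ⟨T, hT0, hT⟩ := o.exists_periodic w he
    have ha0 : a ≠ 0 := by
      rintro rfl
      obtain ⟨k, hk⟩ := hmem T hT
      simp at hk; exact hT0.ne' hk
    refine ⟨|a|, abs_pos.2 ha0, ?_, fun s t hst => ?_⟩
    · rcases abs_choice a with h1 | h1 <;> rw [h1]
      exacts [haP, haP.neg]
    · obtain ⟨k, hk⟩ := hmem _ (o.periodic_of_eq w he hst)
      rcases abs_choice a with h1 | h1 <;> rw [h1]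
      exacts [⟨k, hk⟩, ⟨-k, by rw [hk]; push_cast; ring⟩]

end IsOrbit

/-! ### Thin layers around a periodic orbit -/

/-- A trajectory on the level `{h = e}` together with its smallest positive period `T`. -/
structure IsPeriodicOrbit (h : ℝ × ℝ → ℝ) (e : ℝ) (z : ℝ → ℝ × ℝ) (T : ℝ) : Prop
    extends IsOrbit h e z where
  period_pos : 0 < T
  periodic : Function.Periodic z T
  minimal : ∀ s t, z s = z t → ∃ k : ℤ, s - t = k * T

namespace IsPeriodicOrbit

variable {h : ℝ × ℝ → ℝ} {m : ℝ × ℝ} {e : ℝ} {z : ℝ → ℝ × ℝ} {T : ℝ}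

theorem periodic_tube (o : IsPeriodicOrbit h e z T) (s : ℝ) :
    Function.Periodic (fun t => tube h z (s, t)) T := fun t => by
  simp [tube, o.periodic t]

theorem eventually_forall_abs_energy_tube_sub_le (o : IsPeriodicOrbit h e z T) (w : IsWell h m)
    (he : h m < e) :
    ∀ᶠ s in 𝓝 (0 : ℝ), ∀ t, |h (tube h z (s, t)) - e - s| ≤ 1 / 2 * |s| := by
  have := isCompact_Icc.eventually_forall_of_forall_eventually (x₀ := (0 : ℝ)) (K := Icc 0 T)
    (P := fun s t => |h (tube h z (s, t)) - e - s| ≤ 1 / 2 * |s|)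
    (fun t _ => o.eventually_abs_energy_tube_sub_le w he t)
  filter_upwards [this] with s hs t
  obtain ⟨t', ht', htt'⟩ := (o.periodic_tube s).exists_mem_Ico₀ o.period_pos t
  rw [htt']
  exact hs t' (Ico_subset_Icc_self ht')

/-- The tube is injective near the orbit, because `T` is the smallest period. -/
theorem eventually_injOn_tube (o : IsPeriodicOrbit h e z T) (w : IsWell h m) (he : h m < e) :
    ∀ᶠ δ in 𝓝[>] (0 : ℝ), InjOn (tube h z) (Ioo (-δ) δ ×ˢ Ico 0 T) := by
  have hc := (o.contDiff_tube w he).continuous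
  -- Near coincident base points use local injectivity, near distinct ones continuity.
  have key := (isCompact_Icc.prod isCompact_Icc).eventually_forall_of_forall_eventually
    (x₀ := ((0 : ℝ), (0 : ℝ))) (K := Icc 0 T ×ˢ Icc 0 T)
    (P := fun s t => tube h z (s.1, t.1) = tube h z (s.2, t.2) →
      s.1 = s.2 ∧ ∃ k : ℤ, t.1 - t.2 = k * T) (by
    rintro ⟨t₁, t₂⟩ -
    by_cases hz : z t₁ = z t₂
    · obtain ⟨k, hk⟩ := o.minimal _ _ hz
      obtain ⟨u, hu, huinj⟩ := o.exists_injOn_tube w he t₁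
      have h1 : ∀ᶠ y : (ℝ × ℝ) × ℝ × ℝ in 𝓝 ((0, 0), t₁, t₂), (y.1.1, y.2.1) ∈ u := by
        have : Continuous fun y : (ℝ × ℝ) × ℝ × ℝ => (y.1.1, y.2.1) := by fun_prop
        exact this.continuousAt.eventually hu
      have h2 : ∀ᶠ y : (ℝ × ℝ) × ℝ × ℝ in 𝓝 ((0, 0), t₁, t₂), (y.1.2, y.2.2 + k * T) ∈ u := by
        have : Continuous fun y : (ℝ × ℝ) × ℝ × ℝ => (y.1.2, y.2.2 + k * T) := by fun_prop
        refine this.continuousAt.eventually ?_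
        beta_reduce
        rwa [← hk, add_sub_cancel]
      filter_upwards [h1, h2] with y hy1 hy2 heq
      have := huinj hy1 hy2 (by
        rw [heq]; exact ((o.periodic_tube y.1.2).int_mul k y.2.2).symm)
      rw [Prod.mk.injEq] at this
      exact ⟨this.1, k, by linarith [this.2]⟩
    · have h1 : Continuous fun y : (ℝ × ℝ) × ℝ × ℝ => tube h z (y.1.1, y.2.1) := by fun_prop
      have h2 : Continuous fun y : (ℝ × ℝ) × ℝ × ℝ => tube h z (y.1.2, y.2.2) := by fun_prop
      have h3 := (isOpen_ne_fun h1 h2).mem_nhds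
        (show ((0, 0), t₁, t₂) ∈ _ by simpa [tube_zero] using hz)
      filter_upwards [h3] with y hy heq
      exact absurd heq hy)
  obtain ⟨d, hd, hball⟩ := Metric.eventually_nhds_iff.1 key
  filter_upwards [Ioo_mem_nhdsGT hd] with δ hδ
  rintro ⟨s₁, t₁⟩ ⟨hs₁, ht₁⟩ ⟨s₂, t₂⟩ ⟨hs₂, ht₂⟩ heq
  have hs : dist (s₁, s₂) ((0 : ℝ), (0 : ℝ)) < d := by
    rw [Prod.dist_eq, max_lt_iff, Real.dist_0_eq_abs, Real.dist_0_eq_abs]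
    exact ⟨(abs_lt.2 hs₁).trans hδ.2, (abs_lt.2 hs₂).trans hδ.2⟩
  obtain ⟨h1, k, hk⟩ := hball hs (t₁, t₂)
    ⟨Ico_subset_Icc_self ht₁, Ico_subset_Icc_self ht₂⟩ heq
  have hT := o.period_pos
  simp only [mem_Ico] at ht₁ ht₂ hk h1
  have hk1 : (k : ℝ) < 1 := by
    by_contra hc; nlinarith
  have hk2 : (-1 : ℝ) < k := by
    by_contra hc; nlinarith
  have hk0 : k = 0 := by
    have a1 : k < 1 := by exact_mod_cast hk1
    have a2 : -1 < k := by exact_mod_cast hk2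
    omega
  rw [hk0] at hk
  ext
  · exact h1
  · simp at hk; simpa using sub_eq_zero.1 hk

theorem exists_forall_mem_image_tube (o : IsPeriodicOrbit h e z T) (w : IsWell h m)
    (he : h m < e) {δ : ℝ} (hδ : 0 < δ) :
    ∃ η > 0, ∀ x, |h x - e| < η → x ∈ tube h z '' (Ioo (-δ) δ ×ˢ Ico 0 T) := by
  set U := tube h z '' (Ioo (-δ) δ ×ˢ Ico 0 T) with hU
  have hsub : ∀ x, h x = e → U ∈ 𝓝 x := by
    intro x hx
    obtain ⟨t, rfl⟩ : x ∈ range z := by rw [o.range_eq w he]; exact hx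
    rw [← o.map_nhds_tube w he]
    have : Ioo (-δ) δ ×ˢ univ ∈ 𝓝 ((0 : ℝ), t) :=
      prod_mem_nhds (Ioo_mem_nhds (by linarith) hδ) univ_mem
    filter_upwards [image_mem_map this] with y hy
    obtain ⟨⟨s, r⟩, ⟨hs, -⟩, rfl⟩ := hy
    obtain ⟨r', hr', hrr'⟩ := (o.periodic_tube s).exists_mem_Ico₀ o.period_pos r
    exact ⟨(s, r'), ⟨hs, hr'⟩, hrr'.symm⟩
  have hC : IsCompact ({x | h x ≤ e + 1} \ interior U) :=
    (w.isCompact_sublevel _).diff isOpen_interior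
  have hcont : Continuous fun x => |h x - e| := (w.continuous.sub continuous_const).abs
  rcases ({x | h x ≤ e + 1} \ interior U).eq_empty_or_nonempty with hemp | hne
  · refine ⟨1, one_pos, fun x hx => interior_subset (sdiff_eq_empty.1 hemp ?_)⟩
    have := (abs_lt.1 hx).2
    change h x ≤ e + 1
    linarith
  · obtain ⟨x₀, hx₀, hmin⟩ := hC.exists_isMinOn hne hcont.continuousOn
    have hpos : 0 < |h x₀ - e| := abs_pos.2 fun h0 =>
      hx₀.2 (mem_interior_iff_mem_nhds.2 (hsub x₀ (sub_eq_zero.1 h0)))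
    refine ⟨min 1 |h x₀ - e|, lt_min one_pos hpos, fun x hx => ?_⟩
    by_contra hxU
    have h1 : h x ≤ e + 1 := by linarith [(abs_lt.1 (hx.trans_le (min_le_left _ _))).2]
    exact absurd (hx.trans_le (min_le_right _ _))
      (not_lt.2 (hmin ⟨h1, fun hi => hxU (interior_subset hi)⟩))

/-- Change of variables in an integral concentrated in a thin layer near the level `{h = e}`, with
the transversal coordinate of the tube rescaled by the thickness `ε`. -/
theorem integral_layer_eq (o : IsPeriodicOrbit h e z T) (w : IsWell h m) (he : h m < e)
    {δ η ε : ℝ} (hinj : InjOn (tube h z) (Ioo (-δ) δ ×ˢ Ico 0 T))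
    (hη : ∀ x, |h x - e| < η → x ∈ tube h z '' (Ioo (-δ) δ ×ˢ Ico 0 T))
    (hε0 : ε ≠ 0) (hεη : |ε| < η) {χ : ℝ → ℝ} (hχ : ∀ s, s ∉ Icc (0 : ℝ) 1 → χ s = 0)
    (f : ℝ × ℝ → ℝ) :
    |ε|⁻¹ * ∫ x, χ ((h x - e) / ε) * f x =
      ∫ y, indicator {y : ℝ × ℝ | ε * y.1 ∈ Ioo (-δ) δ ∧ y.2 ∈ Ico 0 T} (fun y =>
        |(fderiv ℝ (tube h z) (ε * y.1, y.2)).det| *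
          (χ ((h (tube h z (ε * y.1, y.2)) - e) / ε) * f (tube h z (ε * y.1, y.2)))) y := by
  set S := {y : ℝ × ℝ | ε * y.1 ∈ Ioo (-δ) δ ∧ y.2 ∈ Ico 0 T} with hS
  have hSm : MeasurableSet S := by
    apply MeasurableSet.inter
    · exact measurableSet_Ioo.preimage (by fun_prop)
    · exact measurableSet_Ico.preimage measurable_snd
  let σ : ℝ × ℝ →L[ℝ] ℝ × ℝ :=
    (ε • ContinuousLinearMap.fst ℝ ℝ ℝ).prod (ContinuousLinearMap.snd ℝ ℝ ℝ)
  have hσ : ∀ y, σ y = (ε * y.1, y.2) := fun y => rfl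
  have himage : (fun y => tube h z (σ y)) '' S = tube h z '' (Ioo (-δ) δ ×ˢ Ico 0 T) := by
    ext x
    constructor
    · rintro ⟨y, hy, rfl⟩
      exact ⟨σ y, hy, rfl⟩
    · rintro ⟨⟨s, t⟩, ⟨hs, ht⟩, rfl⟩
      have : ε * (ε⁻¹ * s) = s := mul_inv_cancel_left₀ hε0 s
      refine ⟨(ε⁻¹ * s, t), ⟨?_, ht⟩, ?_⟩
      · change ε * (ε⁻¹ * s) ∈ _
        rwa [this]
      · simp only [hσ, this]
  have hderiv : ∀ y ∈ S, HasFDerivWithinAt (fun y => tube h z (σ y))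
      ((fderiv ℝ (tube h z) (σ y)).comp σ) S y := fun y _ =>
    (((o.contDiff_tube w he).differentiable one_ne_zero (σ y)).hasFDerivAt.comp y
      σ.hasFDerivAt).hasFDerivWithinAt
  have hdet : ∀ y, ((fderiv ℝ (tube h z) (σ y)).comp σ).det =
      ε * (fderiv ℝ (tube h z) (σ y)).det := by
    intro y
    have h1 : σ (1, 0) = ε • ((1, 0) : ℝ × ℝ) := by simp [hσ]
    have h2 : σ (0, 1) = (0, 1) := by simp [hσ]
    simp only [ContinuousLinearMap.det_prod_real, ContinuousLinearMap.comp_apply, h1, h2, map_smul,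
      Prod.smul_fst, Prod.smul_snd, smul_eq_mul]
    ring
  have hSinj : InjOn (fun y => tube h z (σ y)) S := by
    intro y hy y' hy' heq
    have := @hinj (σ y) hy (σ y') hy' heq
    simp only [hσ, Prod.mk.injEq, mul_right_inj' hε0] at this
    exact Prod.ext this.1 this.2
  have hzero : ∀ x, x ∉ (fun y => tube h z (σ y)) '' S → χ ((h x - e) / ε) * f x = 0 := by
    intro x hx
    rw [hχ, zero_mul]
    intro hmem
    rw [himage] at hx
    refine hx (hη x (lt_of_le_of_lt ?_ hεη))
    have h1 : |(h x - e) / ε| ≤ 1 := abs_le.2 ⟨by linarith [hmem.1], hmem.2⟩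
    rwa [abs_div, div_le_one (abs_pos.2 hε0)] at h1
  rw [← setIntegral_eq_integral_of_forall_compl_eq_zero hzero,
    integral_image_eq_integral_abs_det_fderiv_smul volume hSm hderiv hSinj,
    integral_indicator hSm, ← integral_const_mul]
  refine setIntegral_congr_fun hSm fun y _ => ?_
  rw [hdet, abs_mul, smul_eq_mul, mul_assoc, hσ, inv_mul_cancel_left₀ (abs_pos.2 hε0).ne']

/-- Coarea formula at a single level: averages over thin layers adjacent to `{h = e}` converge to
the integral over the orbit with respect to time. -/
theorem tendsto_integral_layer (o : IsPeriodicOrbit h e z T) (w : IsWell h m) (he : h m < e)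
    {χ : ℝ → ℝ} (hχm : Measurable χ) {C : ℝ} (hχC : ∀ s, |χ s| ≤ C)
    (hχ : ∀ s, s ∉ Icc (0 : ℝ) 1 → χ s = 0)
    (hχc : ∀ s, s ≠ 0 → s ≠ 1 → ContinuousAt χ s)
    {f : ℝ × ℝ → ℝ} (hf : Continuous f) :
    Tendsto (fun ε => |ε|⁻¹ * ∫ x, χ ((h x - e) / ε) * f x) (𝓝[≠] 0)
      (𝓝 ((∫ s, χ s) * ∫ t in (0 : ℝ)..T, f (z t))) := by
  have hT := o.period_pos
  obtain ⟨δ, hinj, hen, hδ⟩ : ∃ δ, InjOn (tube h z) (Ioo (-δ) δ ×ˢ Ico 0 T) ∧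
      (∀ s ∈ Ioo (-δ) δ, ∀ t, |h (tube h z (s, t)) - e - s| ≤ 1 / 2 * |s|) ∧ 0 < δ := by
    obtain ⟨d, hd, hball⟩ := Metric.eventually_nhds_iff.1 (o.eventually_forall_abs_energy_tube_sub_le w he)
    have h1 : ∀ᶠ δ in 𝓝[>] (0 : ℝ), δ ∈ Ioo 0 d := Ioo_mem_nhdsGT hd
    obtain ⟨δ, h2, h3⟩ := ((o.eventually_injOn_tube w he).and h1).exists
    refine ⟨δ, h2, fun s hs => hball ?_, h3.1⟩
    rw [Real.dist_0_eq_abs]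
    exact (abs_lt.2 hs).trans h3.2
  obtain ⟨η, hη0, hη⟩ := o.exists_forall_mem_image_tube w he hδ
  have hWc := (o.contDiff_tube w he).continuous
  have hDc : Continuous fun y => (fderiv ℝ (tube h z) y).det :=
    ContinuousLinearMap.continuous_det.comp
      ((o.contDiff_tube w he).continuous_fderiv one_ne_zero)
  have hbox := isCompact_Icc (a := ((-δ, 0) : ℝ × ℝ)) (b := (δ, T))
  obtain ⟨M₁, hM₁⟩ := hbox.exists_bound_of_continuousOn hDc.continuousOn
  obtain ⟨M₂, hM₂⟩ := hbox.exists_bound_of_continuousOn (hf.comp hWc).continuousOn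
  set G : ℝ → ℝ × ℝ → ℝ := fun ε =>
    indicator {y : ℝ × ℝ | ε * y.1 ∈ Ioo (-δ) δ ∧ y.2 ∈ Ico 0 T} (fun y =>
        |(fderiv ℝ (tube h z) (ε * y.1, y.2)).det| *
          (χ ((h (tube h z (ε * y.1, y.2)) - e) / ε) * f (tube h z (ε * y.1, y.2)))) with hG
  have hGin : ∀ ε (y : ℝ × ℝ), (ε * y.1 ∈ Ioo (-δ) δ ∧ y.2 ∈ Ico 0 T) →
      G ε y = |(fderiv ℝ (tube h z) (ε * y.1, y.2)).det| *
          (χ ((h (tube h z (ε * y.1, y.2)) - e) / ε) * f (tube h z (ε * y.1, y.2))) :=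
    fun ε y hy => indicator_of_mem (s := {y : ℝ × ℝ | ε * y.1 ∈ Ioo (-δ) δ ∧ y.2 ∈ Ico 0 T}) hy _
  have hGout : ∀ ε (y : ℝ × ℝ), ¬(ε * y.1 ∈ Ioo (-δ) δ ∧ y.2 ∈ Ico 0 T) → G ε y = 0 :=
    fun ε y hy =>
      indicator_of_notMem (s := {y : ℝ × ℝ | ε * y.1 ∈ Ioo (-δ) δ ∧ y.2 ∈ Ico 0 T}) hy _
  have hev : ∀ᶠ ε in 𝓝[≠] (0 : ℝ), ε ≠ 0 ∧ |ε| < η := by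
    refine (eventually_mem_nhdsWithin).and (nhdsWithin_le_nhds ?_)
    filter_upwards [Metric.ball_mem_nhds (0 : ℝ) hη0] with ε hε
    simpa using hε
  have hlimit : ∫ y : ℝ × ℝ, χ y.1 * indicator (Ico 0 T) (fun t => f (z t)) y.2 =
      (∫ s, χ s) * ∫ t in (0 : ℝ)..T, f (z t) := by
    rw [Measure.volume_eq_prod, integral_prod_mul (μ := volume) (ν := volume) χ,
      integral_indicator measurableSet_Ico, integral_Ico_eq_integral_Ioc,
      intervalIntegral.integral_of_le hT.le]
  rw [← hlimit]
  refine Tendsto.congr' (f₁ := fun ε => ∫ y, G ε y) ?_ ?_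
  · filter_upwards [hev] with ε hε
    exact (o.integral_layer_eq w he hinj hη hε.1 hε.2 hχ f).symm
  -- In the layer, `h` differs from `e` by at most `|ε|`, which bounds the rescaled transversal
  -- coordinate by `2`; this gives the dominating function.
  refine tendsto_integral_filter_of_dominated_convergence
    (indicator (Icc ((-2, 0) : ℝ × ℝ) (2, T)) fun _ => M₁ * (C * M₂)) ?_ ?_ ?_ ?_
  · refine Eventually.of_forall fun ε => Measurable.aestronglyMeasurable ?_
    refine Measurable.indicator ?_ ?_
    · have hc : Continuous fun y : ℝ × ℝ => (ε * y.1, y.2) := by fun_prop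
      refine (hDc.comp hc).abs.measurable.mul (Measurable.mul ?_ ((hf.comp hWc).comp hc).measurable)
      exact hχm.comp (((w.continuous.comp (hWc.comp hc)).sub continuous_const).div_const
        ε).measurable
    · apply MeasurableSet.inter
      · exact measurableSet_Ioo.preimage (by fun_prop)
      · exact measurableSet_Ico.preimage measurable_snd
  · filter_upwards [hev] with ε hε
    refine Eventually.of_forall fun y => ?_
    have hC : 0 ≤ C := (abs_nonneg _).trans (hχC 0)
    have hmem0 : ((0, 0) : ℝ × ℝ) ∈ Icc ((-δ, 0) : ℝ × ℝ) (δ, T) :=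
      ⟨⟨by simpa using hδ.le, le_rfl⟩, ⟨hδ.le, hT.le⟩⟩
    have hM₁0 : 0 ≤ M₁ := (norm_nonneg _).trans (hM₁ _ hmem0)
    have hM₂0 : 0 ≤ M₂ := (norm_nonneg _).trans (hM₂ _ hmem0)
    have hnn : 0 ≤ indicator (Icc ((-2, 0) : ℝ × ℝ) (2, T)) (fun _ => M₁ * (C * M₂)) y :=
      indicator_nonneg (fun _ _ => by positivity) y
    by_cases hy : ε * y.1 ∈ Ioo (-δ) δ ∧ y.2 ∈ Ico 0 T
    · rw [hGin ε y hy]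
      by_cases hχy : (h (tube h z (ε * y.1, y.2)) - e) / ε ∈ Icc (0 : ℝ) 1
      · have hle : |h (tube h z (ε * y.1, y.2)) - e| ≤ |ε| := by
          have h1 : |(h (tube h z (ε * y.1, y.2)) - e) / ε| ≤ 1 :=
            abs_le.2 ⟨by linarith [hχy.1], hχy.2⟩
          rwa [abs_div, div_le_one (abs_pos.2 hε.1)] at h1
        have h2 := hen _ hy.1 y.2
        have h3 : |ε * y.1| ≤ 2 * |ε| := by
          have := abs_sub_abs_le_abs_sub (ε * y.1) (h (tube h z (ε * y.1, y.2)) - e)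
          rw [abs_sub_comm (ε * y.1)] at this
          linarith
        have h4 : |y.1| ≤ 2 := by
          rw [abs_mul, mul_comm 2] at h3
          exact le_of_mul_le_mul_left h3 (abs_pos.2 hε.1)
        have hyI : y ∈ Icc ((-2, 0) : ℝ × ℝ) (2, T) :=
          ⟨⟨(abs_le.1 h4).1, hy.2.1⟩, ⟨(abs_le.1 h4).2, hy.2.2.le⟩⟩
        have hyJ : (ε * y.1, y.2) ∈ Icc ((-δ, 0) : ℝ × ℝ) (δ, T) :=
          ⟨⟨hy.1.1.le, hy.2.1⟩, ⟨hy.1.2.le, hy.2.2.le⟩⟩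
        rw [indicator_of_mem hyI, norm_mul, norm_mul, Real.norm_eq_abs |_|, abs_abs]
        exact mul_le_mul (hM₁ _ hyJ) (mul_le_mul (hχC _) (hM₂ _ hyJ) (norm_nonneg _) hC)
          (by positivity) hM₁0
      · rw [hχ _ hχy]
        simpa using hnn
    · rw [hGout ε y hy]
      simpa using hnn
  · exact (integrable_indicator_iff measurableSet_Icc).2
      (integrableOn_const isCompact_Icc.measure_lt_top.ne)
  · have hnull : ∀ c : ℝ, ∀ᵐ y : ℝ × ℝ, y.1 ≠ c := by
      intro c
      have : ∀ᵐ s : ℝ, s ≠ c := by simp [ae_iff]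
      exact Measure.quasiMeasurePreserving_fst.ae this
    filter_upwards [hnull 0, hnull 1] with y hy0 hy1
    have hin : ∀ᶠ ε in 𝓝[≠] (0 : ℝ), ε * y.1 ∈ Ioo (-δ) δ := by
      refine nhdsWithin_le_nhds ?_
      have : Continuous fun ε : ℝ => ε * y.1 := by fun_prop
      refine this.continuousAt.eventually (Ioo_mem_nhds ?_ ?_) <;> simpa using hδ
    by_cases hyT : y.2 ∈ Ico 0 T
    · rw [indicator_of_mem hyT]
      have hpath : Tendsto (fun ε : ℝ => (ε * y.1, y.2)) (𝓝[≠] 0) (𝓝 ((0 : ℝ), y.2)) := by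
        have : Continuous fun ε : ℝ => (ε * y.1, y.2) := by fun_prop
        have := this.tendsto 0
        rw [zero_mul] at this
        exact this.mono_left nhdsWithin_le_nhds
      have hquot : Tendsto (fun ε : ℝ => (h (tube h z (ε * y.1, y.2)) - e) / ε) (𝓝[≠] 0)
          (𝓝 y.1) := by
        have h1 : HasDerivAt (fun ε : ℝ => (ε * y.1, y.2)) (y.1, 0) 0 := by
          simpa using ((hasDerivAt_id (0 : ℝ)).mul_const y.1).prodMk (hasDerivAt_const 0 y.2)
        have h2 := (o.hasStrictFDerivAt_energy_tube w he y.2).hasFDerivAt.comp_hasDerivAt_of_eq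
          (0 : ℝ) h1 (by simp)
        have h3 := hasDerivAt_iff_tendsto_slope_zero.1 h2
        refine h3.congr fun ε => ?_
        simp [tube_zero, o.energy, div_eq_inv_mul]
      have hlim : Tendsto (fun ε : ℝ => |(fderiv ℝ (tube h z) (ε * y.1, y.2)).det| *
          (χ ((h (tube h z (ε * y.1, y.2)) - e) / ε) * f (tube h z (ε * y.1, y.2)))) (𝓝[≠] 0)
          (𝓝 (χ y.1 * f (z y.2))) := by
        have h1 := ((hDc.tendsto _).comp hpath).abs
        rw [o.det_fderiv_tube w he, abs_one] at h1
        have h2 := ((hf.comp hWc).tendsto _).comp hpath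
        have h3 := (hχc _ hy0 hy1).tendsto.comp hquot
        simpa [tube_zero, Function.comp_def] using h1.mul (h3.mul h2)
      refine hlim.congr' ?_
      filter_upwards [hin] with ε hε
      rw [hGin ε y ⟨hε, hyT⟩]
    · rw [indicator_of_notMem hyT, mul_zero]
      refine tendsto_const_nhds.congr fun ε => ?_
      rw [hGout ε y fun hc => hyT hc.2]

end IsPeriodicOrbit

theorem IsWell.exists_isPeriodicOrbit {h : ℝ × ℝ → ℝ} {m : ℝ × ℝ} (w : IsWell h m) {e : ℝ}
    {x : ℝ × ℝ} (hx : h x = e) (he : h m < e) :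
    ∃ z T, IsPeriodicOrbit h e z T := by
  subst hx
  obtain ⟨z, -, hz, hze⟩ := w.exists_orbit he
  have o : IsOrbit h (h x) z := ⟨hz, hze⟩
  obtain ⟨T, hT, hper, hmin⟩ := o.exists_minimal_period w he
  exact ⟨z, T, o, hT, hper, hmin⟩

/-! ### The enclosed area as a function of the energy -/

/-- The area enclosed by the level `{h = e}`. -/
noncomputable def area (h : ℝ × ℝ → ℝ) (e : ℝ) : ℝ := volume.real {x | h x ≤ e}

namespace IsWell

variable {h : ℝ × ℝ → ℝ} {m : ℝ × ℝ}

theorem measurableSet_sublevel (w : IsWell h m) (e : ℝ) : MeasurableSet {x | h x ≤ e} :=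
  (w.isCompact_sublevel e).measurableSet

theorem measure_sublevel_ne_top (w : IsWell h m) (e : ℝ) : volume {x | h x ≤ e} ≠ ⊤ :=
  (w.isCompact_sublevel e).measure_lt_top.ne

theorem integrable_indicator_sublevel (w : IsWell h m) (e : ℝ) :
    Integrable (indicator {x | h x ≤ e} (1 : ℝ × ℝ → ℝ)) :=
  (integrable_indicator_iff (w.measurableSet_sublevel e)).2
    (integrableOn_const (w.measure_sublevel_ne_top e))

theorem area_eq_integral (w : IsWell h m) (e : ℝ) :
    area h e = ∫ x, indicator {x | h x ≤ e} (1 : ℝ × ℝ → ℝ) x :=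
  (integral_indicator_one (w.measurableSet_sublevel e)).symm

theorem area_mono (w : IsWell h m) : Monotone (area h) := fun _ b hab =>
  measureReal_mono (fun _ hx => le_trans (α := ℝ) hx hab) (w.measure_sublevel_ne_top b)

theorem area_sub_eq (w : IsWell h m) (e e' : ℝ) {g : ℝ × ℝ → ℝ}
    (hg : ∀ x, indicator {x | h x ≤ e'} (1 : ℝ × ℝ → ℝ) x -
      indicator {x | h x ≤ e} (1 : ℝ × ℝ → ℝ) x = g x) :
    area h e' - area h e = ∫ x, g x := by
  rw [w.area_eq_integral, w.area_eq_integral, ← integral_sub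
    (w.integrable_indicator_sublevel _) (w.integrable_indicator_sublevel _)]
  exact integral_congr_ae (Eventually.of_forall hg)

end IsWell

namespace IsPeriodicOrbit

variable {h : ℝ × ℝ → ℝ} {m : ℝ × ℝ} {e : ℝ} {z : ℝ → ℝ × ℝ} {T : ℝ}

/-- The derivative of the enclosed area with respect to the energy is the period. -/
theorem hasDerivAt_area (o : IsPeriodicOrbit h e z T) (w : IsWell h m) (he : h m < e) :
    HasDerivAt (area h) T e := by
  -- Which endpoints of the unit interval are included depends on the sign of the increment `ε`.
  have key : ∀ I : Set ℝ, MeasurableSet I → Ioo (0 : ℝ) 1 ⊆ I → I ⊆ Icc 0 1 →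
      volume.real I = 1 →
      Tendsto (fun ε => |ε|⁻¹ * ∫ x, indicator I 1 ((h x - e) / ε)) (𝓝[≠] 0) (𝓝 T) := by
    intro I hI h1 h2 hvol
    have := o.tendsto_integral_layer w he (χ := indicator I 1) (f := fun _ => 1) (C := 1)
      (measurable_one.indicator hI) (fun s => ?_) (fun s hs => ?_) (fun s hs0 hs1 => ?_)
      continuous_const
    · simpa [integral_indicator_one hI, hvol] using this
    · by_cases hs : s ∈ I <;> simp [hs]
    · exact indicator_of_notMem (fun hc => hs (h2 hc)) _
    · by_cases hs : s ∈ Ioo (0 : ℝ) 1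
      · have : indicator I (1 : ℝ → ℝ) =ᶠ[𝓝 s] fun _ => 1 := by
          filter_upwards [Ioo_mem_nhds hs.1 hs.2] with r hr
          simp [h1 hr]
        exact continuousAt_const.congr this.symm
      · have hs' : s ∉ Icc (0 : ℝ) 1 := fun hc =>
          hs ⟨lt_of_le_of_ne hc.1 hs0.symm, lt_of_le_of_ne hc.2 hs1⟩
        have : indicator I (1 : ℝ → ℝ) =ᶠ[𝓝 s] fun _ => 0 := by
          filter_upwards [isClosed_Icc.isOpen_compl.mem_nhds hs'] with r hr
          exact indicator_of_notMem (fun hc => hr (h2 hc)) _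
        exact continuousAt_const.congr this.symm
  rw [hasDerivAt_iff_tendsto_slope_zero, ← nhdsLT_sup_nhdsGT, tendsto_sup]
  constructor
  · have := (key (Ico 0 1) measurableSet_Ico Ioo_subset_Ico_self Ico_subset_Icc_self
      (by simp)).mono_left (nhdsLT_le_nhdsNE 0)
    refine this.congr' ?_
    filter_upwards [self_mem_nhdsWithin] with ε hε
    have hε : ε < 0 := hε
    rw [← neg_sub, w.area_sub_eq (e + ε) e (g := fun x => indicator (Ico 0 1) 1 ((h x - e) / ε)),
      abs_of_neg hε, smul_eq_mul, inv_neg, neg_mul, mul_neg]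
    intro x
    by_cases h1 : h x ≤ e <;> by_cases h2 : h x ≤ e + ε
    · have : (h x - e) / ε ∉ Ico (0 : ℝ) 1 := fun hc => by
        have := hc.2; rw [div_lt_iff_of_neg hε] at this; linarith
      rw [indicator_of_notMem this]
      simp [h1, h2]
    · have : (h x - e) / ε ∈ Ico (0 : ℝ) 1 :=
        ⟨div_nonneg_of_nonpos (by linarith) hε.le, by rw [div_lt_iff_of_neg hε]; linarith⟩
      rw [indicator_of_mem this]
      simp [h1, h2]
    · linarith
    · have : (h x - e) / ε ∉ Ico (0 : ℝ) 1 := fun hc => by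
        have := hc.1; rw [le_div_iff_of_neg hε] at this; linarith
      rw [indicator_of_notMem this]
      simp [h1, h2]
  · have := (key (Ioc 0 1) measurableSet_Ioc Ioo_subset_Ioc_self Ioc_subset_Icc_self
      (by simp)).mono_left (nhdsGT_le_nhdsNE 0)
    refine this.congr' ?_
    filter_upwards [self_mem_nhdsWithin] with ε hε
    have hε : 0 < ε := hε
    rw [w.area_sub_eq e (e + ε) (g := fun x => indicator (Ioc 0 1) 1 ((h x - e) / ε)),
      abs_of_pos hε, smul_eq_mul]
    intro x
    by_cases h1 : h x ≤ e <;> by_cases h2 : h x ≤ e + ε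
    · have : (h x - e) / ε ∉ Ioc (0 : ℝ) 1 := fun hc => by
        have := hc.1; rw [lt_div_iff₀ hε] at this; linarith
      rw [indicator_of_notMem this]
      simp [h1, h2]
    · linarith
    · have : (h x - e) / ε ∈ Ioc (0 : ℝ) 1 :=
        ⟨div_pos (by linarith) hε, by rw [div_le_iff₀ hε]; linarith⟩
      rw [indicator_of_mem this]
      simp [h1, h2]
    · have : (h x - e) / ε ∉ Ioc (0 : ℝ) 1 := fun hc => by
        have := hc.2; rw [div_le_iff₀ hε] at this; linarith
      rw [indicator_of_notMem this]
      simp [h1, h2]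

/-- Green's formula for a regular level: the action of the orbit is the enclosed area. -/
theorem integral_action (o : IsPeriodicOrbit h e z T) (w : IsWell h m) (he : h m < e) :
    ∫ t in (0 : ℝ)..T, (z t).1 * (hamiltonianField h (z t)).2 = area h e := by
  set S := Real.smoothTransition with hS
  have hSd : ContDiff ℝ 1 S := Real.smoothTransition.contDiff
  have hder : ∀ s, HasDerivAt S (deriv S s) s := fun s =>
    (hSd.differentiable one_ne_zero s).hasDerivAt
  have hcd : Continuous (deriv S) := hSd.continuous_deriv le_rfl
  have hsupp : ∀ s, s ∉ Icc (0 : ℝ) 1 → deriv S s = 0 := by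
    intro s hs
    rw [mem_Icc, not_and_or, not_le, not_le] at hs
    rcases hs with hs | hs
    · have : S =ᶠ[𝓝 s] fun _ => 0 := by
        filter_upwards [Iio_mem_nhds hs] with r hr
        exact Real.smoothTransition.zero_of_nonpos (le_of_lt hr)
      rw [this.deriv_eq, deriv_const]
    · have : S =ᶠ[𝓝 s] fun _ => 1 := by
        filter_upwards [Ioi_mem_nhds hs] with r hr
        exact Real.smoothTransition.one_of_one_le (le_of_lt hr)
      rw [this.deriv_eq, deriv_const]
  obtain ⟨C, hC⟩ := (HasCompactSupport.intro isCompact_Icc hsupp).exists_bound_of_continuous hcd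
  have hint : ∫ s, deriv S s = 1 := by
    rw [← setIntegral_eq_integral_of_forall_compl_eq_zero hsupp, integral_Icc_eq_integral_Ioc,
      ← intervalIntegral.integral_of_le zero_le_one,
      intervalIntegral.integral_eq_sub_of_hasDerivAt (fun s _ => hder s)
        (hcd.intervalIntegrable _ _)]
    simp [hS]
  have hfc : Continuous fun x : ℝ × ℝ => x.1 * (hamiltonianField h x).2 :=
    continuous_fst.mul (continuous_snd.comp w.contDiff_hamiltonianField.continuous)
  have hlim := o.tendsto_integral_layer w he hcd.measurable hC hsupp
    (fun s _ _ => hcd.continuousAt) hfc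
  rw [hint, one_mul] at hlim
  have hlim' := hlim.mono_left (nhdsGT_le_nhdsNE 0)
  -- Integration by parts identifies the layer averages with the smoothed areas.
  have hparts : ∀ ε : ℝ, 0 < ε →
      |ε|⁻¹ * ∫ x, deriv S ((h x - e) / ε) * (x.1 * (hamiltonianField h x).2) =
        ∫ x, (1 - S ((h x - e) / ε)) := by
    intro ε hε
    have hg : ∀ x, HasFDerivAt (fun x => 1 - S ((h x - e) / ε))
        (-(deriv S ((h x - e) / ε) • (ε⁻¹ • fderiv ℝ h x))) x := by
      intro x
      have h1 : HasFDerivAt (fun x => (h x - e) / ε) (ε⁻¹ • fderiv ℝ h x) x := by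
        simp only [div_eq_inv_mul]
        exact ((w.hasFDerivAt x).sub_const e).const_smul ε⁻¹
      exact ((hder _).comp_hasFDerivAt x h1).const_sub 1
    have hgc : Continuous fun x => 1 - S ((h x - e) / ε) :=
      continuous_iff_continuousAt.2 fun x => (hg x).continuousAt
    have hgs : ∀ x, x ∉ {x | h x ≤ e + ε} → 1 - S ((h x - e) / ε) = 0 := by
      intro x hx
      rw [sub_eq_zero, eq_comm]
      apply Real.smoothTransition.one_of_one_le
      rw [le_div_iff₀ hε]
      have : e + ε < h x := not_le.1 hx
      linarith
    have hgs' : ∀ x, x ∉ {x | h x ≤ e + ε} → deriv S ((h x - e) / ε) = 0 := by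
      intro x hx
      refine hsupp _ fun hc => ?_
      have := hc.2
      rw [div_le_iff₀ hε] at this
      exact hx (show h x ≤ e + ε by linarith)
    have hK := w.isCompact_sublevel (e + ε)
    have hch : Continuous fun x => deriv S ((h x - e) / ε) :=
      hcd.comp ((w.continuous.sub continuous_const).div_const ε)
    have hfd : ∀ x, fderiv ℝ (fun x => 1 - S ((h x - e) / ε)) x (1, 0) =
        -(ε⁻¹ * (deriv S ((h x - e) / ε) * (hamiltonianField h x).2)) := by
      intro x
      rw [(hg x).fderiv]
      simp [hamiltonianField]
      ring
    have hX2 : Continuous fun x => (hamiltonianField h x).2 :=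
      continuous_snd.comp w.contDiff_hamiltonianField.continuous
    have := integral_mul_fderiv_eq_neg_fderiv_mul_of_integrable (μ := (volume : Measure (ℝ × ℝ)))
      (f := fun x : ℝ × ℝ => x.1)
      (g := fun x => 1 - S ((h x - e) / ε)) (v := ((1 : ℝ), (0 : ℝ))) ?_ ?_ ?_
      (fun x _ => differentiableAt_fst) (fun x _ => (hg x).differentiableAt)
    · have hfst : ∀ x : ℝ × ℝ, fderiv ℝ (fun x : ℝ × ℝ => x.1) x (1, 0) = 1 := fun x => by
        rw [fderiv_fst]; rfl
      simp only [hfd, hfst, one_mul, mul_neg, integral_neg, neg_inj] at this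
      rw [← this, abs_of_pos hε, ← integral_const_mul]
      congr 1; ext x; ring
    · have hfst : ∀ x : ℝ × ℝ, fderiv ℝ (fun x : ℝ × ℝ => x.1) x (1, 0) = 1 := fun x => by
        rw [fderiv_fst]; rfl
      simp only [hfst, one_mul]
      exact hgc.integrable_of_hasCompactSupport (HasCompactSupport.intro hK hgs)
    · simp only [hfd]
      refine Continuous.integrable_of_hasCompactSupport (by fun_prop)
        (HasCompactSupport.intro hK fun x hx => ?_)
      simp [hgs' x hx]
    · refine Continuous.integrable_of_hasCompactSupport (by fun_prop)
        (HasCompactSupport.intro hK fun x hx => ?_)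
      simp only [hgs x hx, mul_zero]
  have hcompact : ∀ ε : ℝ, 0 < ε → area h e ≤ ∫ x, (1 - S ((h x - e) / ε)) ∧
      ∫ x, (1 - S ((h x - e) / ε)) ≤ area h (e + ε) := by
    intro ε hε
    have hint : Integrable fun x => 1 - S ((h x - e) / ε) := by
      refine Continuous.integrable_of_hasCompactSupport
        (continuous_const.sub (hSd.continuous.comp
          ((w.continuous.sub continuous_const).div_const ε)))
        (HasCompactSupport.intro (w.isCompact_sublevel (e + ε)) fun x hx => ?_)
      rw [sub_eq_zero, eq_comm]
      apply Real.smoothTransition.one_of_one_le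
      rw [le_div_iff₀ hε]
      have : e + ε < h x := not_le.1 hx
      linarith
    rw [w.area_eq_integral, w.area_eq_integral]
    constructor
    · refine integral_mono (w.integrable_indicator_sublevel _) hint fun x => ?_
      by_cases hx : h x ≤ e
      · have : S ((h x - e) / ε) = 0 := Real.smoothTransition.zero_of_nonpos
          (div_nonpos_of_nonpos_of_nonneg (by linarith) hε.le)
        simp [hx, this]
      · simpa [hx] using Real.smoothTransition.le_one _
    · refine integral_mono hint (w.integrable_indicator_sublevel _) fun x => ?_
      by_cases hx : h x ≤ e + ε
      · simpa [hx] using Real.smoothTransition.nonneg _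
      · have : S ((h x - e) / ε) = 1 := by
          apply Real.smoothTransition.one_of_one_le
          rw [le_div_iff₀ hε]
          linarith
        simp [hx, this]
  have hright : Tendsto (fun ε => area h (e + ε)) (𝓝[>] 0) (𝓝 (area h e)) := by
    have h1 : ContinuousAt (fun ε => area h (e + ε)) 0 :=
      ContinuousAt.comp (g := area h)
        (by rw [add_zero]; exact (o.hasDerivAt_area w he).continuousAt) (by fun_prop)
    have h2 := h1.tendsto
    rw [add_zero] at h2
    exact h2.mono_left nhdsWithin_le_nhds
  have hlim2 : Tendsto (fun ε : ℝ => ∫ x, (1 - S ((h x - e) / ε))) (𝓝[>] 0) (𝓝 (area h e)) := by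
    refine tendsto_of_tendsto_of_tendsto_of_le_of_le' tendsto_const_nhds hright ?_ ?_
    · filter_upwards [self_mem_nhdsWithin] with ε hε using (hcompact ε hε).1
    · filter_upwards [self_mem_nhdsWithin] with ε hε using (hcompact ε hε).2
  refine tendsto_nhds_unique hlim' (hlim2.congr' ?_)
  filter_upwards [self_mem_nhdsWithin] with ε hε using (hparts ε hε).symm

end IsPeriodicOrbit

namespace IsWell

variable {h : ℝ × ℝ → ℝ} {m : ℝ × ℝ}

theorem exists_eq_of_min_le (w : IsWell h m) {e : ℝ} (he : h m ≤ e) : ∃ x, h x = e := by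
  obtain ⟨x, hx⟩ := (w.proper.eventually (eventually_ge_atTop e)).exists
  exact mem_range_of_exists_le_of_exists_ge w.continuous ⟨m, he⟩ ⟨x, hx⟩

theorem exists_isPeriodicOrbit_of_lt (w : IsWell h m) {e : ℝ} (he : h m < e) :
    ∃ z T, IsPeriodicOrbit h e z T := by
  obtain ⟨x, hx⟩ := w.exists_eq_of_min_le he.le
  exact w.exists_isPeriodicOrbit hx he

theorem area_eq_zero (w : IsWell h m) {e : ℝ} (he : e ≤ h m) : area h e = 0 := by
  have : {x | h x ≤ e} ⊆ {m} := fun x hx => by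
    by_contra hxm
    exact absurd (w.min_lt x hxm) (not_lt.2 (le_trans (α := ℝ) hx he))
  rw [area, measureReal_def, measure_mono_null this (by simp)]
  rfl

/-- The enclosed area is continuous also at the minimum, where its derivative may be infinite. -/
theorem continuous_area (w : IsWell h m) : Continuous (area h) := by
  rw [continuous_iff_continuousAt]
  intro e
  rcases lt_or_ge (h m) e with he | he
  · obtain ⟨z, T, o⟩ := w.exists_isPeriodicOrbit_of_lt he
    exact (o.hasDerivAt_area w he).continuousAt
  rw [continuousAt_iff_continuous_left'_right']
  constructor
  · refine tendsto_const_nhds.congr' ?_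
    filter_upwards [self_mem_nhdsWithin] with r hr
    rw [w.area_eq_zero he, w.area_eq_zero (le_trans (le_of_lt hr) he)]
  · have h1 := tendsto_measure_biInter_gt (μ := (volume : Measure (ℝ × ℝ)))
      (s := fun r => {x | h x ≤ r}) (a := e)
      (fun r _ => (w.measurableSet_sublevel r).nullMeasurableSet)
      (fun i j _ hij x hx => le_trans (α := ℝ) hx hij)
      ⟨e + 1, by simp, w.measure_sublevel_ne_top _⟩
    have h2 : (⋂ r > e, {x | h x ≤ r}) = {x | h x ≤ e} := by
      ext x
      simp only [mem_iInter, mem_ofPred_eq]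
      exact ⟨fun hx => le_of_forall_gt_imp_ge_of_dense hx, fun hx r hr => hx.trans hr.le⟩
    rw [h2] at h1
    exact (ENNReal.tendsto_toReal (w.measure_sublevel_ne_top e)).comp h1

theorem strictMonoOn_area (w : IsWell h m) : StrictMonoOn (area h) (Ici (h m)) := by
  refine strictMonoOn_of_deriv_pos (convex_Ici _) w.continuous_area.continuousOn fun e he => ?_
  rw [interior_Ici] at he
  obtain ⟨z, T, o⟩ := w.exists_isPeriodicOrbit_of_lt he
  rw [(o.hasDerivAt_area w he).deriv]
  exact o.period_pos

theorem exists_area_eq (w : IsWell h m) {a : ℝ} (ha : 0 ≤ a) : ∃ e, h m ≤ e ∧ area h e = a := by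
  have h1 : Tendsto (fun r : ℝ => volume {x | h x ≤ r}) atTop (𝓝 ⊤) := by
    have := tendsto_measure_iUnion_atTop (μ := (volume : Measure (ℝ × ℝ)))
      (s := fun r : ℝ => {x | h x ≤ r}) (fun r s hrs x hx => le_trans (α := ℝ) hx hrs)
    have hU : (⋃ r : ℝ, {x | h x ≤ r}) = univ :=
      eq_univ_of_forall fun x => mem_iUnion.2 ⟨h x, le_refl (h x)⟩
    rwa [hU, measure_univ_of_isAddLeftInvariant] at this
  obtain ⟨b, hb, hbm⟩ := ((h1.eventually (lt_mem_nhds (ENNReal.ofReal_lt_top (r := a)))).and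
    (eventually_ge_atTop (h m))).exists
  have hb' : a ≤ area h b := (ENNReal.ofReal_le_iff_le_toReal (w.measure_sublevel_ne_top b)).1 hb.le
  obtain ⟨e, he, hea⟩ := intermediate_value_Icc hbm w.continuous_area.continuousOn
    (show a ∈ Icc (area h (h m)) (area h b) from ⟨by rwa [w.area_eq_zero le_rfl], hb'⟩)
  exact ⟨e, he.1, hea⟩

end IsWell

/-! ### Actions of closed curves in a level -/

theorem area_nonneg (h : ℝ × ℝ → ℝ) (e : ℝ) : 0 ≤ area h e := measureReal_nonneg

namespace IsWell

variable {h : ℝ × ℝ → ℝ} {m : ℝ × ℝ}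

theorem energy_eq_of_hasDerivAt_smul (w : IsWell h m) {lam : ℝ → ℝ} {c : ℝ → ℝ × ℝ}
    (hc : ∀ t, HasDerivAt c (lam t • hamiltonianField h (c t)) t) (t : ℝ) : h (c t) = h (c 0) := by
  have hd : ∀ t, HasDerivAt (fun s => h (c s)) 0 t := fun t => by
    simpa [map_smul, fderiv_hamiltonianField] using w.hasDerivAt_comp (hc t)
  exact is_const_of_deriv_eq_zero (fun t => (hd t).differentiableAt) (fun t => (hd t).deriv) t 0

/-- A closed curve following the Hamiltonian field at a speed `lam` of constant sign `σ` runs a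
positive number of times around its level, so that its signed action is at least the enclosed
area. -/
theorem area_le_integral_of_periodic (w : IsWell h m) {lam : ℝ → ℝ} (hlam : Continuous lam)
    {σ : ℝ} (hσ : σ * σ = 1) (hpos : ∀ t, 0 < σ * lam t) {c : ℝ → ℝ × ℝ}
    (hc : ∀ t, HasDerivAt c (lam t • hamiltonianField h (c t)) t) {τ : ℝ} (hτ : 0 < τ)
    (hper : Function.Periodic c τ) :
    area h (h (c 0)) ≤
      σ * ∫ t in (0 : ℝ)..τ, (c t).1 * (lam t • hamiltonianField h (c t)).2 := by
  have hen := w.energy_eq_of_hasDerivAt_smul hc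
  rcases eq_or_ne (c 0) m with hm | hm
  · have hcm : ∀ t, c t = m := fun t => by
      by_contra hne
      have := w.min_lt _ hne
      rw [hen, hm] at this
      exact lt_irrefl _ this
    simp [hcm, w.hamiltonianField_min, w.area_eq_zero le_rfl]
  have he := w.min_lt _ hm
  obtain ⟨z, T, o⟩ := w.exists_isPeriodicOrbit_of_lt he
  obtain ⟨t₀, ht₀⟩ : c 0 ∈ range z := by rw [o.range_eq w he]; exact rfl
  set θ : ℝ → ℝ := fun t => t₀ + ∫ s in (0 : ℝ)..t, lam s with hθ
  have hθd : ∀ t, HasDerivAt θ (lam t) t := fun t =>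
    (intervalIntegral.integral_hasDerivAt_right (hlam.intervalIntegrable _ _)
      (hlam.stronglyMeasurableAtFilter _ _) hlam.continuousAt).const_add t₀
  have hθ0 : θ 0 = t₀ := by simp [hθ]
  have hcz : c = fun t => z (θ t) :=
    w.eq_of_hasDerivAt_smul he hlam hc hen (fun t => (o.hasDerivAt (θ t)).scomp t (hθd t))
      (fun t => o.energy _) (t₀ := 0) (by rw [hθ0, ht₀])
  obtain ⟨k, hk⟩ := o.minimal (θ τ) (θ 0) (by
    have := hper 0
    rw [zero_add, hcz] at this
    exact this)
  have hTpos := o.period_pos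
  have hσk : 0 < σ * k := by
    have h1 : 0 < ∫ s in (0 : ℝ)..τ, σ * lam s :=
      intervalIntegral.intervalIntegral_pos_of_pos ((hlam.const_mul σ).intervalIntegrable _ _) hpos hτ
    rw [intervalIntegral.integral_const_mul] at h1
    have h2 : ∫ s in (0 : ℝ)..τ, lam s = k * T := by
      rw [← hk, hθ0]; simp [hθ]
    rw [h2, ← mul_assoc] at h1
    exact pos_of_mul_pos_left h1 hTpos.le
  have hσk1 : 1 ≤ σ * k := by
    rcases mul_self_eq_one_iff.1 hσ with rfl | rfl
    · rw [one_mul] at hσk ⊢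
      exact_mod_cast hσk
    · rw [neg_one_mul] at hσk ⊢
      have : 0 < -k := by exact_mod_cast hσk
      have : 1 ≤ -k := this
      exact_mod_cast this
  have hg : Continuous fun s => (z s).1 * (hamiltonianField h (z s)).2 :=
    (continuous_fst.comp o.continuous).mul
      (continuous_snd.comp (w.contDiff_hamiltonianField.continuous.comp o.continuous))
  have hint : ∫ t in (0 : ℝ)..τ, (c t).1 * (lam t • hamiltonianField h (c t)).2 =
      k * area h (h (c 0)) := by
    have h1 := intervalIntegral.integral_comp_mul_deriv (a := 0) (b := τ)
      (fun t _ => hθd t) hlam.continuousOn hg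
    have h2 : Function.Periodic (fun s => (z s).1 * (hamiltonianField h (z s)).2) T := fun s => by
      simp only [o.periodic s]
    have h3 := h2.intervalIntegral_add_zsmul_eq k (θ 0) (hg.intervalIntegrable)
    rw [zsmul_eq_mul, zsmul_eq_mul, ← hk, add_sub_cancel, h2.intervalIntegral_add_eq (θ 0) 0,
      zero_add, o.integral_action w he] at h3
    rw [← h3, ← h1]
    refine intervalIntegral.integral_congr fun t _ => ?_
    simp only [hcz, Function.comp_apply, Prod.smul_snd, smul_eq_mul]
    ring
  rw [hint, ← mul_assoc]
  exact le_mul_of_one_le_left (area_nonneg h _) hσk1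

theorem measurable_area_comp (w : IsWell h m) : Measurable fun x => area h (h x) :=
  (w.continuous_area.comp w.continuous).measurable

/-- The function `area h ∘ h` is distributed like Lebesgue measure on `[0, ∞)`. -/
theorem volume_area_comp_le (w : IsWell h m) (b : ℝ) :
    volume {x | area h (h x) ≤ b} = ENNReal.ofReal b := by
  rcases lt_or_ge b 0 with hb | hb
  · have : {x | area h (h x) ≤ b} = ∅ :=
      eq_empty_of_forall_notMem fun x hx =>
        absurd (hb.trans_le (area_nonneg h (h x))) (not_lt.2 hx)
    rw [this, measure_empty, ENNReal.ofReal_of_nonpos hb.le]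
  · obtain ⟨e, he, rfl⟩ := w.exists_area_eq hb
    have : {x | area h (h x) ≤ area h e} = {x | h x ≤ e} := by
      ext x
      exact w.strictMonoOn_area.le_iff_le (w.min_le x) he
    rw [this, area, ofReal_measureReal (w.measure_sublevel_ne_top e)]

end IsWell

/-! ### Volume of sublevel sets of sums -/

section Volume

theorem map_eq_restrict_Ici {α : Type*} [MeasureSpace α] {f : α → ℝ} (hf : Measurable f)
    (hvol : ∀ b, volume {x | f x ≤ b} = ENNReal.ofReal b) :
    Measure.map f volume = volume.restrict (Ici 0) := by
  symm
  refine Measure.ext_of_Ioc _ _ fun a b hab => ?_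
  have h1 : ∀ b, (volume.restrict (Ici (0 : ℝ))) (Iic b) = ENNReal.ofReal b := fun b => by
    rw [Measure.restrict_apply measurableSet_Iic, inter_comm, Ici_inter_Iic, Real.volume_Icc,
      sub_zero]
  have h2 : ∀ b, Measure.map f volume (Iic b) = ENNReal.ofReal b := fun b => by
    rw [Measure.map_apply hf measurableSet_Iic]
    exact hvol b
  rw [← Iic_sdiff_Iic, measure_sdiff (Iic_subset_Iic.2 hab.le) measurableSet_Iic.nullMeasurableSet
    (by rw [h1]; exact ENNReal.ofReal_ne_top), measure_sdiff (Iic_subset_Iic.2 hab.le)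
    measurableSet_Iic.nullMeasurableSet (by rw [h2]; exact ENNReal.ofReal_ne_top),
    h1, h1, h2, h2]

/-- If the distribution function of each `f i` is that of Lebesgue measure on `[0, ∞)`, the
distribution of `∑ f i` is given by the volume of a simplex. -/
theorem volume_sum_lt {n : ℕ} {α : Type*} [MeasureSpace α] [SigmaFinite (volume : Measure α)]
    {f : Fin n → α → ℝ} (hf : ∀ i, Measurable (f i))
    (hvol : ∀ i b, volume {x | f i x ≤ b} = ENNReal.ofReal b) (c : ℝ) :
    volume {y : Fin n → α | ∑ i, f i (y i) < c} =
      (Measure.pi fun _ : Fin n => volume.restrict (Ici (0 : ℝ))) {a | ∑ i, a i < c} := by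
  have hmp := measurePreserving_pi (fun _ : Fin n => (volume : Measure α))
    (fun _ => volume.restrict (Ici (0 : ℝ))) (f := f)
    (fun i => ⟨hf i, map_eq_restrict_Ici (hf i) (hvol i)⟩)
  have hm : MeasurableSet {a : Fin n → ℝ | ∑ i, a i < c} :=
    measurableSet_lt (by fun_prop) measurable_const
  rw [← hmp.measure_preimage hm.nullMeasurableSet]
  rfl

/-- The volume is computed by comparison with the `ℓ¹` ball, for which `f i x = 2 * |x|`. -/
theorem volume_sum_lt_eq {n : ℕ} (hn : 0 < n) {α : Type*} [MeasureSpace α]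
    [SigmaFinite (volume : Measure α)] {f : Fin n → α → ℝ} (hf : ∀ i, Measurable (f i))
    (hvol : ∀ i b, volume {x | f i x ≤ b} = ENNReal.ofReal b) {c : ℝ} (hc : 0 ≤ c) :
    volume {y : Fin n → α | ∑ i, f i (y i) < c} = ENNReal.ofReal (c ^ n / (n ! : ℝ)) := by
  have : Nonempty (Fin n) := ⟨⟨0, hn⟩⟩
  have hball := volume_sum_rpow_lt (Fin n) (p := 1) le_rfl (c / 2)
  have hcross := volume_sum_lt (n := n) (f := fun _ x => 2 * |x|) (fun _ => by fun_prop)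
    (fun _ b => by
      have : {x : ℝ | 2 * |x| ≤ b} = Icc (-(b / 2)) (b / 2) := by
        ext x
        rw [mem_Icc, ← abs_le, mem_ofPred_eq, le_div_iff₀ two_pos, mul_comm]
      rw [this, Real.volume_Icc]
      ring_nf) c
  rw [volume_sum_lt hf hvol c, ← hcross]
  have hset : {y : Fin n → ℝ | ∑ i, 2 * |y i| < c} =
      {x : Fin n → ℝ | (∑ i, |x i| ^ (1 : ℝ)) ^ (1 / (1 : ℝ)) < c / 2} := by
    ext y
    simp only [Real.rpow_one, div_one, mem_ofPred_eq, ← Finset.mul_sum]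
    rw [lt_div_iff₀ (zero_lt_two' ℝ), mul_comm]
  rw [hset, hball, Fintype.card_fin, div_one, div_one, Real.Gamma_nat_eq_factorial,
    ← ENNReal.ofReal_pow (by positivity), ← ENNReal.ofReal_mul (by positivity)]
  congr 1
  have h2 : Real.Gamma (1 + 1) = 1 := by
    rw [Real.Gamma_add_one one_ne_zero, Real.Gamma_one, one_mul]
  rw [h2, mul_one, div_pow]
  field_simp

end Volume

section Simplex

variable {n : ℕ} {H : Fin n → ℝ × ℝ → ℝ} {m : Fin n → ℝ × ℝ}

/-- If the areas of the wells sum to at least `c` whenever the energies sum to `E`, then the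
sublevel set of energy `E` contains the points whose areas sum to less than `c`, a set with the
volume of a simplex. -/
theorem ofReal_le_volume_sublevel (hn : 0 < n) (w : ∀ i, IsWell (H i) (m i)) {E c : ℝ}
    (hE : ∑ i, H i (m i) ≤ E) (hc0 : 0 ≤ c)
    (hc : ∀ e : Fin n → ℝ, (∀ i, H i (m i) ≤ e i) → ∑ i, e i = E → c ≤ ∑ i, area (H i) (e i)) :
    ENNReal.ofReal (c ^ n / (n ! : ℝ)) ≤ volume {x : PhaseSpace n | sumHamiltonian H x ≤ E} := by
  rw [← volume_sum_lt_eq hn (fun i => (w i).measurable_area_comp)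
    (fun i => (w i).volume_area_comp_le) hc0]
  have hmp := volume_measurePreserving_arrowProdEquivProdArrow ℝ ℝ (Fin n)
  rw [← hmp.measure_preimage_equiv]
  refine measure_mono fun y hy => ?_
  change ∑ i, H i (y i) ≤ E
  by_contra hlt
  rw [not_le] at hlt
  -- Lower the energies of `y` proportionally towards the minima until they sum to `E`.
  set M := ∑ i, H i (m i) with hM
  set S := ∑ i, H i (y i) with hS
  set r := (E - M) / (S - M) with hr
  have hSM : 0 < S - M := by linarith
  have hr0 : 0 ≤ r := div_nonneg (by linarith) hSM.le
  have hr1 : r ≤ 1 := (div_le_one hSM).2 (by linarith)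
  have hnn : ∀ i, 0 ≤ H i (y i) - H i (m i) := fun i => sub_nonneg.2 ((w i).min_le _)
  have := hc (fun i => H i (m i) + r * (H i (y i) - H i (m i)))
    (fun i => le_add_of_nonneg_right (mul_nonneg hr0 (hnn i))) (by
      rw [Finset.sum_add_distrib, ← Finset.mul_sum, Finset.sum_sub_distrib, ← hM, ← hS, hr,
        div_mul_cancel₀ _ hSM.ne']
      ring)
  refine absurd hy (not_lt.2 (this.trans (Finset.sum_le_sum fun i _ => (w i).area_mono ?_)))
  have := mul_le_of_le_one_left (hnn i) hr1
  linarith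

end Simplex

/-! ### Characteristic directions of a regular level -/

section Tangent

variable {F : Type*} [NormedAddCommGroup F] [NormedSpace ℝ F]

theorem HasDerivAt.mem_tangentConeAt {c : ℝ → F} {v : F} {t : ℝ} {S : Set F}
    (hc : HasDerivAt c v t) (hS : ∀ᶠ s in 𝓝 t, c s ∈ S) : v ∈ tangentConeAt ℝ S (c t) := by
  have h1 := (hc.hasFDerivAt.hasFDerivWithinAt (s := {s | c s ∈ S})).mapsTo_tangent_cone
  have h2 : tangentConeAt ℝ {s | c s ∈ S} t = univ := by
    rw [← univ_inter {s | c s ∈ S}, tangentConeAt_inter_nhds hS, tangentConeAt_univ]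
  have h3 := h1 (show (1 : ℝ) ∈ _ by rw [h2]; trivial)
  refine tangentConeAt_mono ?_ (by simpa using h3)
  rintro _ ⟨s, hs, rfl⟩
  exact hs

/-- The tangent cone of a regular level is the kernel of the derivative. -/
theorem tangentConeAt_level [CompleteSpace F] {f : F → ℝ} {f' : F →L[ℝ] ℝ} {x : F}
    (hf : HasStrictFDerivAt f f' x) (hf' : f' ≠ 0) : tangentConeAt ℝ {y | f y = f x} x = {v | f' v = 0} := by
  ext v
  constructor
  · intro hv
    have h1 : HasFDerivWithinAt f (0 : F →L[ℝ] ℝ) {y | f y = f x} x :=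
      (hasFDerivWithinAt_const (f x) x _).congr (fun y hy => hy) rfl
    exact hf.hasFDerivAt.hasFDerivWithinAt.unique_on h1 hv
  · intro hv
    have hsurj : f'.range = ⊤ := by
      refine LinearMap.range_eq_top.2 ?_
      exact LinearMap.surjective (f := (f' : F →ₗ[ℝ] ℝ)) fun h0 =>
        hf' (ContinuousLinearMap.coe_injective h0)
    let u : f'.ker := ⟨v, hv⟩
    have h1 := (hf.to_implicitFunction hsurj).hasFDerivAt
    have h2 : HasDerivAt (fun t : ℝ => t • u) u 0 := by
      simpa using (hasDerivAt_id (0 : ℝ)).smul_const u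
    have h3 := h1.comp_hasDerivAt_of_eq (0 : ℝ) h2 (by simp)
    have h4 := (hf.map_implicitFunction_eq hsurj)
    have h5 : Tendsto (fun t : ℝ => (f x, t • u)) (𝓝 0) (𝓝 (f x, 0)) := by
      have : Continuous fun t : ℝ => (f x, t • u) := by fun_prop
      simpa using this.tendsto 0
    have h6 := h3.mem_tangentConeAt (S := {y | f y = f x}) (h5.eventually h4)
    simpa [hf.implicitFunction_apply_image hsurj] using h6

theorem frontier_sublevel_eq {f : F → ℝ} {E : ℝ} (hf : Continuous f)
    (hreg : ∀ x, f x = E → fderiv ℝ f x ≠ 0) : frontier {x | f x ≤ E} = {x | f x = E} := by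
  refine (frontier_le_subset_eq hf continuous_const).antisymm fun x hx => ?_
  refine ⟨subset_closure (le_of_eq hx), fun hi => hreg x hx ?_⟩
  refine IsLocalMax.fderiv_eq_zero ?_
  filter_upwards [mem_interior_iff_mem_nhds.1 hi] with y hy
  rw [show f x = E from hx]
  exact hy

end Tangent

/-! ### Closed characteristics of a direct sum -/

/-- The Hamiltonian vector field of `sumHamiltonian H`: a direct sum of planar fields. -/
noncomputable def sumHamiltonianField {n : ℕ} (H : Fin n → ℝ × ℝ → ℝ) (x : PhaseSpace n) :
    PhaseSpace n :=
  (fun i => (hamiltonianField (H i) (x.1 i, x.2 i)).1,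
    fun i => (hamiltonianField (H i) (x.1 i, x.2 i)).2)

section DirectSum

variable {n : ℕ} {H : Fin n → ℝ × ℝ → ℝ} {m : Fin n → ℝ × ℝ} {E : ℝ}

/-- The projection of phase space to the plane of the `i`-th momentum and coordinate. -/
def planeProj (n : ℕ) (i : Fin n) : PhaseSpace n →L[ℝ] ℝ × ℝ :=
  ((ContinuousLinearMap.proj i : (Fin n → ℝ) →L[ℝ] ℝ).comp
      (ContinuousLinearMap.fst ℝ (Fin n → ℝ) (Fin n → ℝ))).prod
    ((ContinuousLinearMap.proj i : (Fin n → ℝ) →L[ℝ] ℝ).comp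
      (ContinuousLinearMap.snd ℝ (Fin n → ℝ) (Fin n → ℝ)))

theorem planeProj_apply (i : Fin n) (x : PhaseSpace n) : planeProj n i x = (x.1 i, x.2 i) := rfl

theorem continuous_sumHamiltonianField (w : ∀ i, IsWell (H i) (m i)) :
    Continuous (sumHamiltonianField H) := by
  have h1 : ∀ i, Continuous fun x : PhaseSpace n => hamiltonianField (H i) (planeProj n i x) :=
    fun i => (w i).contDiff_hamiltonianField.continuous.comp (planeProj n i).continuous
  exact (continuous_pi fun i => continuous_fst.comp (h1 i)).prodMk
    (continuous_pi fun i => continuous_snd.comp (h1 i))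

theorem contDiff_sumHamiltonian (w : ∀ i, IsWell (H i) (m i)) : ContDiff ℝ 2 (sumHamiltonian H) :=
  ContDiff.sum fun i _ => (w i).contDiff.comp (planeProj n i).contDiff

theorem fderiv_sumHamiltonian (w : ∀ i, IsWell (H i) (m i)) (x v : PhaseSpace n) :
    fderiv ℝ (sumHamiltonian H) x v =
      ∑ i, fderiv ℝ (H i) (planeProj n i x) (planeProj n i v) := by
  have h1 : HasFDerivAt (sumHamiltonian H)
      (∑ i, (fderiv ℝ (H i) (planeProj n i x)).comp (planeProj n i)) x :=
    HasFDerivAt.fun_sum fun i _ => ((w i).hasFDerivAt _).comp x (planeProj n i).hasFDerivAt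
  rw [h1.fderiv, sum_apply]
  rfl

theorem symplecticForm_sumHamiltonianField (w : ∀ i, IsWell (H i) (m i)) (x v : PhaseSpace n) :
    symplecticForm (sumHamiltonianField H x) v = -fderiv ℝ (sumHamiltonian H) x v := by
  rw [fderiv_sumHamiltonian w, symplecticForm, ← Finset.sum_neg_distrib]
  refine Finset.sum_congr rfl fun i _ => ?_
  rw [fderiv_apply_eq]
  simp only [sumHamiltonianField, hamiltonianField, planeProj_apply]
  ring

theorem exists_ne_of_energy_gt {x : PhaseSpace n} (hx : ∑ i, H i (m i) < sumHamiltonian H x) :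
    ∃ i, planeProj n i x ≠ m i := by
  by_contra! hc
  refine hx.ne ?_
  rw [sumHamiltonian]
  exact Finset.sum_congr rfl fun i _ => by rw [← hc i]; rfl

theorem sumHamiltonianField_ne_zero (w : ∀ i, IsWell (H i) (m i)) {x : PhaseSpace n}
    (hx : ∑ i, H i (m i) < sumHamiltonian H x) : sumHamiltonianField H x ≠ 0 := by
  obtain ⟨i, hi⟩ := exists_ne_of_energy_gt hx
  intro h0
  refine (w i).hamiltonianField_ne_zero hi (Prod.ext ?_ ?_)
  · exact congrFun (congrArg Prod.fst h0) i
  · exact congrFun (congrArg Prod.snd h0) i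

/-- The symplectic form is nondegenerate. -/
theorem symplecticForm_eq_zero_of_forall {v : PhaseSpace n}
    (hv : ∀ u, symplecticForm v u = 0) : v = 0 := by
  ext i
  · have := hv (0, Pi.single i 1)
    simpa [symplecticForm, Pi.single_apply] using this
  · have := hv (Pi.single i 1, 0)
    simpa [symplecticForm, Pi.single_apply] using this

theorem symplecticForm_add_smul_right (v u u' : PhaseSpace n) (a : ℝ) :
    symplecticForm v (u + a • u') = symplecticForm v u + a * symplecticForm v u' := by
  simp only [symplecticForm, Finset.mul_sum, ← Finset.sum_add_distrib]
  refine Finset.sum_congr rfl fun i _ => ?_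
  simp only [Prod.fst_add, Prod.snd_add, Prod.smul_fst, Prod.smul_snd, Pi.add_apply, Pi.smul_apply,
    smul_eq_mul]
  ring

theorem symplecticForm_add_smul_left (v v' u : PhaseSpace n) (a : ℝ) :
    symplecticForm (v + a • v') u = symplecticForm v u + a * symplecticForm v' u := by
  simp only [symplecticForm, Finset.mul_sum, ← Finset.sum_add_distrib]
  refine Finset.sum_congr rfl fun i _ => ?_
  simp only [Prod.fst_add, Prod.snd_add, Prod.smul_fst, Prod.smul_snd, Pi.add_apply, Pi.smul_apply,
    smul_eq_mul]
  ring

theorem fderiv_sumHamiltonian_ne_zero (w : ∀ i, IsWell (H i) (m i)) {x : PhaseSpace n}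
    (hx : ∑ i, H i (m i) < sumHamiltonian H x) : fderiv ℝ (sumHamiltonian H) x ≠ 0 := by
  intro h0
  refine sumHamiltonianField_ne_zero w hx (symplecticForm_eq_zero_of_forall fun u => ?_)
  rw [symplecticForm_sumHamiltonianField w, h0]
  simp

theorem frontier_sumHamiltonian (w : ∀ i, IsWell (H i) (m i)) (hE : ∑ i, H i (m i) < E) :
    frontier {x | sumHamiltonian H x ≤ E} = {x | sumHamiltonian H x = E} :=
  frontier_sublevel_eq (contDiff_sumHamiltonian w).continuous fun x hx =>
    fderiv_sumHamiltonian_ne_zero w (by rwa [hx])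

theorem boundaryTangent_sumHamiltonian (w : ∀ i, IsWell (H i) (m i)) (hE : ∑ i, H i (m i) < E)
    {x : PhaseSpace n} (hx : sumHamiltonian H x = E) :
    boundaryTangent {x | sumHamiltonian H x ≤ E} x =
      {v | fderiv ℝ (sumHamiltonian H) x v = 0} := by
  rw [boundaryTangent, frontier_sumHamiltonian w hE, ← hx]
  exact tangentConeAt_level ((contDiff_sumHamiltonian w).contDiffAt.hasStrictFDerivAt two_ne_zero)
    (fderiv_sumHamiltonian_ne_zero w (by rwa [hx]))

/-- The characteristic line of a level is spanned by the Hamiltonian field. -/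
theorem mem_characteristicDirections_iff (w : ∀ i, IsWell (H i) (m i))
    (hE : ∑ i, H i (m i) < E) {x : PhaseSpace n} (hx : sumHamiltonian H x = E)
    {v : PhaseSpace n} : v ∈ characteristicDirections {x | sumHamiltonian H x ≤ E} x ↔
      ∃ a : ℝ, v = a • sumHamiltonianField H x := by
  have hT := boundaryTangent_sumHamiltonian w hE hx
  set D := fderiv ℝ (sumHamiltonian H) x with hD
  constructor
  · rintro ⟨-, hv⟩
    obtain ⟨u, hu⟩ : ∃ u, D u ≠ 0 := by
      by_contra! hc
      exact fderiv_sumHamiltonian_ne_zero w (by rwa [hx]) (ContinuousLinearMap.ext hc)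
    set a := symplecticForm v u / D u with ha
    have key : ∀ y, symplecticForm v y = a * D y := by
      intro y
      have h1 := hv (y + (-(D y / D u)) • u) (by
        rw [hT]
        change D _ = 0
        rw [map_add, map_smul, smul_eq_mul]
        field_simp
        ring)
      rw [symplecticForm_add_smul_right] at h1
      rw [ha, div_mul_eq_mul_div, mul_div_assoc, mul_comm]
      linarith
    refine ⟨-a, ?_⟩
    rw [← sub_eq_zero, neg_smul, sub_neg_eq_add]
    refine symplecticForm_eq_zero_of_forall fun y => ?_
    rw [symplecticForm_add_smul_left, key, symplecticForm_sumHamiltonianField w]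
    ring
  · rintro ⟨a, rfl⟩
    have h1 : ∀ y, symplecticForm (a • sumHamiltonianField H x) y = -(a * D y) := fun y => by
      have := symplecticForm_add_smul_left 0 (sumHamiltonianField H x) y a
      rw [zero_add, symplecticForm_sumHamiltonianField w] at this
      rw [this]
      simp [symplecticForm, hD]
    refine ⟨?_, fun y hy => ?_⟩
    · rw [hT]
      change D _ = 0
      rw [map_smul, hD, fderiv_sumHamiltonian w]
      simp only [smul_eq_mul]
      rw [Finset.sum_eq_zero, mul_zero]
      exact fun i _ => fderiv_hamiltonianField (H i) _
    · rw [hT] at hy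
      rw [h1, show D y = 0 from hy, mul_zero, neg_zero]

/-- The speed of a closed characteristic relative to the Hamiltonian field is continuous and never
vanishes, so it has constant sign. -/
theorem IsClosedCharacteristic.exists_speed (w : ∀ i, IsWell (H i) (m i))
    (hE : ∑ i, H i (m i) < E) {γ : ℝ → PhaseSpace n} {T : ℝ}
    (hγ : IsClosedCharacteristic {x | sumHamiltonian H x ≤ E} γ T) :
    ∃ (lam : ℝ → ℝ) (σ : ℝ), Continuous lam ∧ σ * σ = 1 ∧ (∀ t, 0 < σ * lam t) ∧
      ∀ t, deriv γ t = lam t • sumHamiltonianField H (γ t) := by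
  have hlev : ∀ t, sumHamiltonian H (γ t) = E := fun t => by
    have := hγ.mem_frontier t
    rwa [frontier_sumHamiltonian w hE] at this
  have hex : ∀ t, ∃ a : ℝ, deriv γ t = a • sumHamiltonianField H (γ t) := fun t =>
    (mem_characteristicDirections_iff w hE (hlev t)).1 (hγ.velocity_mem t)
  choose lam hlam using hex
  have hne : ∀ t, lam t ≠ 0 := fun t h0 => hγ.velocity_ne_zero t (by rw [hlam, h0, zero_smul])
  have hX0 : ∀ t, sumHamiltonianField H (γ t) ≠ 0 := fun t =>
    sumHamiltonianField_ne_zero w (by rwa [hlev])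
  have hXc : Continuous fun t => sumHamiltonianField H (γ t) :=
    (continuous_sumHamiltonianField w).comp hγ.contDiff.continuous
  have hdc : Continuous (deriv γ) := hγ.contDiff.continuous_deriv le_rfl
  let B : PhaseSpace n → PhaseSpace n → ℝ := fun u v => ∑ i, (u.1 i * v.1 i + u.2 i * v.2 i)
  have hBpos : ∀ u, u ≠ 0 → B u u ≠ 0 := by
    intro u hu h0
    refine hu ?_
    have h1 := (Finset.sum_eq_zero_iff_of_nonneg
      (fun i _ => add_nonneg (mul_self_nonneg (u.1 i)) (mul_self_nonneg (u.2 i)))).1 h0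
    ext i
    · have := h1 i (Finset.mem_univ i)
      exact mul_self_eq_zero.1 (by nlinarith [mul_self_nonneg (u.1 i), mul_self_nonneg (u.2 i)])
    · have := h1 i (Finset.mem_univ i)
      exact mul_self_eq_zero.1 (by nlinarith [mul_self_nonneg (u.1 i), mul_self_nonneg (u.2 i)])
  -- An explicit formula for the speed shows that it is continuous.
  have hB : ∀ t, lam t = B (deriv γ t) (sumHamiltonianField H (γ t)) /
      B (sumHamiltonianField H (γ t)) (sumHamiltonianField H (γ t)) := by
    intro t
    rw [eq_div_iff (hBpos _ (hX0 t)), hlam]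
    simp only [B, Finset.mul_sum]
    refine Finset.sum_congr rfl fun i _ => ?_
    simp only [Prod.smul_fst, Prod.smul_snd, Pi.smul_apply, smul_eq_mul]
    ring
  have hlamc : Continuous lam := by
    rw [show lam = _ from funext hB]
    have hBc : Continuous fun y : PhaseSpace n × PhaseSpace n => B y.1 y.2 := by fun_prop
    exact (hBc.comp (hdc.prodMk hXc)).div (hBc.comp (hXc.prodMk hXc)) fun t => hBpos _ (hX0 t)
  have hsign : (∀ t, 0 < lam t) ∨ ∀ t, lam t < 0 := by
    by_contra! hc
    obtain ⟨⟨s, hs⟩, t, ht⟩ := hc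
    obtain ⟨r, hr⟩ := mem_range_of_exists_le_of_exists_ge hlamc ⟨s, hs⟩ ⟨t, ht⟩
    exact hne r hr
  rcases hsign with hs | hs
  · exact ⟨lam, 1, hlamc, by norm_num, fun t => by simpa using hs t, hlam⟩
  · exact ⟨lam, -1, hlamc, by norm_num, fun t => by simpa using hs t, hlam⟩

/-- All planar components run around their levels in the same direction, so their actions add up
without cancellation. -/
theorem IsClosedCharacteristic.sum_area_le (w : ∀ i, IsWell (H i) (m i))
    (hE : ∑ i, H i (m i) < E) {γ : ℝ → PhaseSpace n} {T : ℝ}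
    (hγ : IsClosedCharacteristic {x | sumHamiltonian H x ≤ E} γ T) :
    ∑ i, area (H i) (H i (planeProj n i (γ 0))) ≤ |action γ T| := by
  obtain ⟨lam, σ, hlamc, hσ, hpos, hlam⟩ := hγ.exists_speed w hE
  have hd : ∀ i t, HasDerivAt (fun t => planeProj n i (γ t))
      (lam t • hamiltonianField (H i) (planeProj n i (γ t))) t := by
    intro i t
    have h1 := (hγ.contDiff.differentiable one_ne_zero t).hasDerivAt
    have h2 := (planeProj n i).hasFDerivAt.comp_hasDerivAt t h1
    rw [hlam, map_smul] at h2
    exact h2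
  have hle : ∀ i, area (H i) (H i (planeProj n i (γ 0))) ≤
      σ * ∫ t in (0 : ℝ)..T, (γ t).1 i * (deriv γ t).2 i := by
    intro i
    have := (w i).area_le_integral_of_periodic hlamc hσ hpos (hd i) hγ.period_pos
      (fun t => by simp only [hγ.periodic t])
    simp only [hlam]
    exact this
  have hdc : Continuous (deriv γ) := hγ.contDiff.continuous_deriv le_rfl
  have hγc := hγ.contDiff.continuous
  have hact : action γ T = ∑ i, ∫ t in (0 : ℝ)..T, (γ t).1 i * (deriv γ t).2 i := by
    rw [action]
    refine intervalIntegral.integral_finsetSum fun i _ => Continuous.intervalIntegrable ?_ _ _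
    fun_prop
  have hσ1 : |σ| = 1 := by
    rcases mul_self_eq_one_iff.1 hσ with rfl | rfl <;> simp
  calc ∑ i, area (H i) (H i (planeProj n i (γ 0)))
      ≤ ∑ i, σ * ∫ t in (0 : ℝ)..T, (γ t).1 i * (deriv γ t).2 i :=
        Finset.sum_le_sum fun i _ => hle i
    _ = σ * action γ T := by rw [← Finset.mul_sum, hact]
    _ ≤ |σ * action γ T| := le_abs_self _
    _ = |action γ T| := by rw [abs_mul, hσ1, one_mul]

/-- At a minimum of the total area among the energies of sum `E`, all nontrivial orbits have the
same period (Lagrange multipliers). -/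
theorem period_eq_of_isMinimal (w : ∀ i, IsWell (H i) (m i)) {e : Fin n → ℝ}
    (hmin : ∀ e' : Fin n → ℝ, (∀ i, H i (m i) ≤ e' i) → ∑ i, e' i = ∑ i, e i →
      ∑ i, area (H i) (e i) ≤ ∑ i, area (H i) (e' i))
    (he : ∀ i, H i (m i) ≤ e i) {i j : Fin n} (hi : H i (m i) < e i) (hj : H j (m j) < e j)
    {zi zj : ℝ → ℝ × ℝ} {Ti Tj : ℝ} (oi : IsPeriodicOrbit (H i) (e i) zi Ti)
    (oj : IsPeriodicOrbit (H j) (e j) zj Tj) : Ti = Tj := by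
  rcases eq_or_ne i j with rfl | hij
  · exact ((oi.hasDerivAt_area (w i) hi).unique (oj.hasDerivAt_area (w i) hi))
  set g : ℝ → ℝ := fun s => area (H i) (e i + s) + area (H j) (e j - s) with hg
  have hd : HasDerivAt g (Ti - Tj) 0 := by
    have h1 : HasDerivAt (fun s => area (H i) (e i + s)) Ti 0 := by
      have : HasDerivAt (area (H i)) Ti (e i + 0) := by
        rw [add_zero]; exact oi.hasDerivAt_area (w i) hi
      exact this.comp_const_add (e i) 0
    have h2 : HasDerivAt (fun s => area (H j) (e j - s)) (-Tj) 0 := by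
      have : HasDerivAt (area (H j)) Tj (e j - 0) := by
        rw [sub_zero]; exact oj.hasDerivAt_area (w j) hj
      exact this.comp_const_sub (e j) 0
    exact h1.add h2
  have hloc : IsLocalMin g 0 := by
    filter_upwards [Ioo_mem_nhds (sub_neg.2 hi) (sub_pos.2 hj)] with s hs
    set e' : Fin n → ℝ := e + Pi.single i s - Pi.single j s with he'
    have hi' : e' i = e i + s := by simp [he', hij]
    have hj' : e' j = e j - s := by simp [he', hij.symm]
    have hk' : ∀ k, k ≠ i → k ≠ j → e' k = e k := fun k h1 h2 => by simp [he', h1, h2]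
    have hge : ∀ k, H k (m k) ≤ e' k := by
      intro k
      by_cases h1 : k = i
      · subst h1; rw [hi']; linarith [hs.1]
      by_cases h2 : k = j
      · subst h2; rw [hj']; linarith [hs.2]
      rw [hk' k h1 h2]; exact he k
    have hsum : ∑ k, e' k = ∑ k, e k := by
      simp [he', Finset.sum_add_distrib, Finset.sum_sub_distrib]
    have hle := hmin e' hge hsum
    have hsplit : ∀ f : Fin n → ℝ, ∑ k, f k =
        f i + f j + ∑ k ∈ (Finset.univ.erase i).erase j, f k := fun f => by
      rw [← Finset.add_sum_erase _ f (Finset.mem_univ i),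
        ← Finset.add_sum_erase _ f (Finset.mem_erase.2 ⟨hij.symm, Finset.mem_univ j⟩), add_assoc]
    rw [hsplit, hsplit fun k => area (H k) (e' k)] at hle
    have hrest : ∑ k ∈ (Finset.univ.erase i).erase j, area (H k) (e' k) =
        ∑ k ∈ (Finset.univ.erase i).erase j, area (H k) (e k) := by
      refine Finset.sum_congr rfl fun k hk => ?_
      rw [Finset.mem_erase, Finset.mem_erase] at hk
      rw [hk' k hk.2.1 hk.1]
    rw [hrest, hi', hj'] at hle
    simp only [hg, add_zero, sub_zero]
    linarith
  exact sub_eq_zero.1 (hloc.hasDerivAt_eq_zero hd)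

/-- The orbits of a common period on the planar levels of energies `e i` combine to a closed
characteristic. -/
theorem exists_isClosedCharacteristic (w : ∀ i, IsWell (H i) (m i)) (hE : ∑ i, H i (m i) < E)
    {e : Fin n → ℝ} (hsum : ∑ i, e i = E) {T : ℝ} (hT : 0 < T)
    (horb : ∀ i, ∃ z : ℝ → ℝ × ℝ, IsOrbit (H i) (e i) z ∧ Function.Periodic z T ∧
      ∫ t in (0 : ℝ)..T, (z t).1 * (hamiltonianField (H i) (z t)).2 = area (H i) (e i)) :
    ∃ γ, IsClosedCharacteristic {x | sumHamiltonian H x ≤ E} γ T ∧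
      action γ T = ∑ i, area (H i) (e i) := by
  choose z o hper hint using horb
  set γ : ℝ → PhaseSpace n := fun t => (fun i => (z i t).1, fun i => (z i t).2) with hγ
  have hd : ∀ t, HasDerivAt γ (sumHamiltonianField H (γ t)) t := fun t =>
    (hasDerivAt_pi.2 fun i => ((o i).hasDerivAt t).fst).prodMk
      (hasDerivAt_pi.2 fun i => ((o i).hasDerivAt t).snd)
  have hlev : ∀ t, sumHamiltonian H (γ t) = E := fun t => by
    rw [← hsum]
    exact Finset.sum_congr rfl fun i _ => (o i).energy t
  have hderiv : deriv γ = fun t => sumHamiltonianField H (γ t) := funext fun t => (hd t).deriv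
  have hγc : Continuous γ := continuous_iff_continuousAt.2 fun t => (hd t).continuousAt
  refine ⟨γ, ⟨?_, hT, fun t => ?_, fun t => ?_, fun t => ?_, fun t => ?_⟩, ?_⟩
  · rw [contDiff_one_iff_deriv]
    refine ⟨fun t => (hd t).differentiableAt, ?_⟩
    rw [hderiv]
    exact (continuous_sumHamiltonianField w).comp hγc
  · simp only [hγ, hper _ t]
  · rw [frontier_sumHamiltonian w hE]; exact hlev t
  · rw [hderiv]; exact sumHamiltonianField_ne_zero w (by rwa [hlev])
  · exact (mem_characteristicDirections_iff w hE (hlev t)).2 ⟨1, by rw [hderiv, one_smul]⟩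
  · rw [action, hderiv, intervalIntegral.integral_finsetSum]
    · exact Finset.sum_congr rfl fun i _ => hint i
    · intro i _
      exact Continuous.intervalIntegrable ((continuous_fst.comp (o i).continuous).mul
        (continuous_snd.comp ((w i).contDiff_hamiltonianField.continuous.comp
          (o i).continuous))) _ _

theorem exists_minimal_energies (hn : 0 < n) (w : ∀ i, IsWell (H i) (m i))
    (hE : ∑ i, H i (m i) < E) :
    ∃ e : Fin n → ℝ, (∀ i, H i (m i) ≤ e i) ∧ ∑ i, e i = E ∧
      ∀ e' : Fin n → ℝ, (∀ i, H i (m i) ≤ e' i) → ∑ i, e' i = E →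
        ∑ i, area (H i) (e i) ≤ ∑ i, area (H i) (e' i) := by
  set K : Set (Fin n → ℝ) := {e | (∀ i, H i (m i) ≤ e i) ∧ ∑ i, e i = E} with hK
  have hclosed : IsClosed K := by
    have h1 : IsClosed {e : Fin n → ℝ | ∀ i, H i (m i) ≤ e i} := by
      simp only [ofPred_forall]
      exact isClosed_iInter fun i => isClosed_le continuous_const (continuous_apply i)
    exact h1.inter (isClosed_eq (by fun_prop) continuous_const)
  have hcompact : IsCompact K := by
    refine (isCompact_Icc (a := fun i => H i (m i))
      (b := fun i => H i (m i) + (E - ∑ j, H j (m j)))).of_isClosed_subset hclosed ?_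
    rintro e ⟨h1, h2⟩
    refine ⟨h1, fun i => ?_⟩
    have := Finset.single_le_sum (f := fun j => e j - H j (m j))
      (fun j _ => sub_nonneg.2 (h1 j)) (Finset.mem_univ i)
    rw [Finset.sum_sub_distrib, h2] at this
    change e i ≤ _
    linarith
  have hne : K.Nonempty := by
    refine ⟨(fun i => H i (m i)) + Pi.single ⟨0, hn⟩ (E - ∑ j, H j (m j)), fun i => ?_, ?_⟩
    · have : 0 ≤ (Pi.single ⟨0, hn⟩ (E - ∑ j, H j (m j)) : Fin n → ℝ) :=
        Pi.single_nonneg.2 (sub_pos.2 hE).le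
      exact le_add_of_nonneg_right (this i)
    · simp [Finset.sum_add_distrib]
  have hcont : Continuous fun e : Fin n → ℝ => ∑ i, area (H i) (e i) :=
    continuous_finsetSum _ fun i _ => (w i).continuous_area.comp (continuous_apply i)
  obtain ⟨e, ⟨he1, he2⟩, hmin⟩ := hcompact.exists_isMinOn hne hcont.continuousOn
  exact ⟨e, he1, he2, fun e' h1 h2 => hmin ⟨h1, h2⟩⟩

/-- The smallest total area among the energies of sum `E` is the action of a closed
characteristic. -/
theorem exists_isClosedCharacteristic_of_minimal (w : ∀ i, IsWell (H i) (m i))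
    (hE : ∑ i, H i (m i) < E) {e : Fin n → ℝ} (he : ∀ i, H i (m i) ≤ e i) (hsum : ∑ i, e i = E)
    (hmin : ∀ e' : Fin n → ℝ, (∀ i, H i (m i) ≤ e' i) → ∑ i, e' i = E →
      ∑ i, area (H i) (e i) ≤ ∑ i, area (H i) (e' i)) :
    ∃ γ T, IsClosedCharacteristic {x | sumHamiltonian H x ≤ E} γ T ∧
      action γ T = ∑ i, area (H i) (e i) := by
  obtain ⟨i₀, hi₀⟩ : ∃ i, H i (m i) < e i := by
    by_contra! hc
    exact absurd (Finset.sum_le_sum fun i (_ : i ∈ Finset.univ) => hc i) (by rw [hsum]; linarith)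
  obtain ⟨z₀, T, o₀⟩ := (w i₀).exists_isPeriodicOrbit_of_lt hi₀
  refine ⟨_, T, (exists_isClosedCharacteristic w hE hsum o₀.period_pos fun i => ?_).choose_spec⟩
  rcases (he i).lt_or_eq with hi | hi
  · obtain ⟨z, T', o⟩ := (w i).exists_isPeriodicOrbit_of_lt hi
    obtain rfl : T' = T := period_eq_of_isMinimal w
      (fun e' h1 h2 => hmin e' h1 (h2.trans hsum)) he hi hi₀ o o₀
    exact ⟨z, o.toIsOrbit, o.periodic, o.integral_action (w i) hi⟩
  -- A component without energy rests at the minimum.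
  · refine ⟨fun _ => m i, ⟨fun t => ?_, fun _ => hi⟩, fun _ => rfl, ?_⟩
    · rw [(w i).hamiltonianField_min]; exact hasDerivAt_const _ _
    · simp [(w i).hamiltonianField_min, ← hi, (w i).area_eq_zero le_rfl]

end DirectSum

theorem theorem3 (n : ℕ) (hn : 0 < n) (H : Fin n → ℝ × ℝ → ℝ)
    (hsmooth : ∀ i, ContDiff ℝ 2 (H i))
    (hproper : ∀ i, Filter.Tendsto (H i) (Filter.cocompact (ℝ × ℝ)) Filter.atTop)
    (hmin : ∀ i, ∃ m : ℝ × ℝ, (∀ x, x ≠ m → H i m < H i x) ∧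
      ∀ x, x ≠ m → fderiv ℝ (H i) x ≠ 0)
    (E : ℝ) (hE : ∃ x : PhaseSpace n, sumHamiltonian H x < E) :
    ViterboHolds {x : PhaseSpace n | sumHamiltonian H x ≤ E} := by
  choose m hm using hmin
  have w : ∀ i, IsWell (H i) (m i) := fun i =>
    ⟨hsmooth i, hproper i, (hm i).1, (hm i).2⟩
  have hE' : ∑ i, H i (m i) < E := by
    obtain ⟨x, hx⟩ := hE
    exact (Finset.sum_le_sum fun i _ => (w i).min_le _).trans_lt hx
  obtain ⟨e, he, hsum, hle⟩ := exists_minimal_energies hn w hE'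
  have hc0 : 0 ≤ ∑ i, area (H i) (e i) := Finset.sum_nonneg fun i _ => area_nonneg _ _
  have hleast : IsLeast (closedCharacteristicActions {x : PhaseSpace n | sumHamiltonian H x ≤ E})
      (∑ i, area (H i) (e i)) := by
    constructor
    · obtain ⟨γ, T, hγ, hact⟩ := exists_isClosedCharacteristic_of_minimal w hE' he hsum hle
      exact ⟨γ, T, hγ, by rw [hact, abs_of_nonneg hc0]⟩
    · rintro _ ⟨γ, T, hγ, rfl⟩
      refine le_trans (hle _ (fun i => (w i).min_le _) ?_) (hγ.sum_area_le w hE')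
      have := hγ.mem_frontier 0
      rw [frontier_sumHamiltonian w hE'] at this
      exact this
  have hc : cEHZ {x : PhaseSpace n | sumHamiltonian H x ≤ E} = ∑ i, area (H i) (e i) :=
    hleast.csInf_eq
  rw [ViterboHolds, hc]
  exact ⟨hleast, ofReal_le_volume_sublevel hn w hE'.le hc0 hle⟩
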